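/- For $\gamma\in\mathbb C$ with $\operatorname{Re}\gamma>-1$ and $x\in\mathbb R$ let $$\mathrm{Ai}_\gamma(x)=\frac1\pi\int_0^\infty \sigma^\gamma\cos\Big(\frac{\sigma^3}3+x\sigma-\frac{\gamma\pi}2\Big)\,d\sigma,\qquad \mathrm{Gi}_\gamma(x)=\frac1\pi\int_0^\infty \sigma^\gamma\sin\Big(\frac{\sigma^3}3+x\sigma-\frac{\gamma\pi}2\Big)\,d\sigma,\qquad \mathrm{Hi}_\gamma(x)=\frac1\pi\int_0^\infty \sigma^\gamma e^{-\sigma^3/3+\sigma x}\,d\sigma ,$$ where the first two integrals are oscillatory integrals, i.e. $\lim_{\varepsilon\to0+}$ of the absolutely convergent integrals with the additional factor $e^{-\varepsilon\sigma}$. These limits exist, the third integral converges absolutely, and for $-1<\operatorname{Re}\gamma<2$ the first two integrals also converge, to the same values, as improper integrals $\lim_{R\to\infty}\int_0^R$. Write $[f,g]=fg'-f'g$. (i) If $-1<\operatorname{Re}\gamma<0$ (so that $\operatorname{Re}(-1-\gamma)>-1$ as well), then on $\mathbb R$ $$[\mathrm{Ai}_\gamma,\mathrm{Gi}_\gamma]=\frac{\Gamma(1+\gamma)}\pi\,\mathrm{Ai}_{-1-\gamma},$$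 $$[\mathrm{Ai}_\gamma,\mathrm{Hi}_\gamma]=\frac{\Gamma(1+\gamma)}\pi\big(-\cos(\pi\gamma)\,\mathrm{Ai}_{-1-\gamma}-\sin(\pi\gamma)\,\mathrm{Gi}_{-1-\gamma}\big),$$ $$[\mathrm{Gi}_\gamma,\mathrm{Hi}_\gamma]=\frac{\Gamma(1+\gamma)}\pi\big(\sin(\pi\gamma)\,\mathrm{Ai}_{-1-\gamma}-\cos(\pi\gamma)\,\mathrm{Gi}_{-1-\gamma}+\mathrm{Hi}_{-1-\gamma}\big).$$ (ii) If $\operatorname{Re}\gamma>-1$, then the Wronskian determinant of $(\mathrm{Ai}_\gamma,\mathrm{Gi}_\gamma,\mathrm{Hi}_\gamma)$ is equal to $\Gamma(\gamma+1)/\pi^2$ at every $x\in\mathbb R$, and the three functions form a fundamental system for $(1+\gamma)u+xu'-u'''=0$ on $\mathbb R$: they are linearly independent over $\mathbb C$, and the $C^3$ solutions $u:\mathbb R\to\mathbb C$ are exactly their complex linear combinations. -/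

import Mathlib

open Filter Topology MeasureTheory Set

namespace GenAiry

noncomputable section

/-- `HasOscIntegral f a`: the integral of `f` over `(0, ∞)` exists and equals `a` as an oscillatory
integral, that is, it is the limit as `ε` tends to `0+` of the absolutely convergent integrals
with the regularizing factor `exp (-ε σ)`. -/
def HasOscIntegral (f : ℝ → ℂ) (a : ℂ) : Prop :=
  (∀ ε : ℝ, 0 < ε → IntegrableOn (fun σ : ℝ => (Real.exp (-ε * σ) : ℂ) * f σ) (Ioi 0)) ∧
    Tendsto (fun ε : ℝ => ∫ σ in Ioi (0 : ℝ), (Real.exp (-ε * σ) : ℂ) * f σ) (𝓝[>] 0) (𝓝 a)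

/-- The value of the oscillatory integral of `f` over `(0, ∞)`. -/
def oscIntegral (f : ℝ → ℂ) : ℂ :=
  limUnder (𝓝[>] (0 : ℝ)) (fun ε : ℝ => ∫ σ in Ioi (0 : ℝ), (Real.exp (-ε * σ) : ℂ) * f σ)

/-- The phase `σ³/3 + x σ - γ π / 2`. -/
def phase (γ : ℂ) (x σ : ℝ) : ℂ :=
  (σ : ℂ) ^ 3 / 3 + (x : ℂ) * (σ : ℂ) - γ * (Real.pi : ℂ) / 2

/-- The integrand `σ ^ γ cos (σ³/3 + x σ - γ π / 2)` of `Ai_γ(x)`. -/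
def aiIntegrand (γ : ℂ) (x σ : ℝ) : ℂ := (σ : ℂ) ^ γ * Complex.cos (phase γ x σ)

/-- The integrand `σ ^ γ sin (σ³/3 + x σ - γ π / 2)` of `Gi_γ(x)`. -/
def giIntegrand (γ : ℂ) (x σ : ℝ) : ℂ := (σ : ℂ) ^ γ * Complex.sin (phase γ x σ)

/-- The integrand `σ ^ γ exp (-σ³/3 + σ x)` of `Hi_γ(x)`. -/
def hiIntegrand (γ : ℂ) (x σ : ℝ) : ℂ :=
  (σ : ℂ) ^ γ * Complex.exp (-(σ : ℂ) ^ 3 / 3 + (σ : ℂ) * (x : ℂ))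

/-- The generalized Airy function `Ai_γ`, for `Re γ > -1`. -/
def Ai (γ : ℂ) (x : ℝ) : ℂ := 1 / (Real.pi : ℂ) * oscIntegral (aiIntegrand γ x)

/-- The generalized Scorer function `Gi_γ`, for `Re γ > -1`. -/
def Gi (γ : ℂ) (x : ℝ) : ℂ := 1 / (Real.pi : ℂ) * oscIntegral (giIntegrand γ x)

/-- The generalized Scorer function `Hi_γ`, for `Re γ > -1`. -/
def Hi (γ : ℂ) (x : ℝ) : ℂ := 1 / (Real.pi : ℂ) * ∫ σ in Ioi (0 : ℝ), hiIntegrand γ x σ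

/-- The bracket `[f, g] = f g' - f' g`. -/
def bracket (f g : ℝ → ℂ) (x : ℝ) : ℂ := f x * deriv g x - deriv f x * g x

/-- The Wronskian determinant of three functions. -/
def wronskian (u : Fin 3 → ℝ → ℂ) (x : ℝ) : ℂ :=
  Matrix.det (Matrix.of fun i j : Fin 3 => iteratedDeriv (i : ℕ) (u j) x)

/-- Classical solutions on the real line of `(1 + γ) u + x u' - u''' = 0`. -/
def IsSolution (γ : ℂ) (u : ℝ → ℂ) : Prop :=
  ContDiff ℝ 3 u ∧
    ∀ x : ℝ, (1 + γ) * u x + (x : ℂ) * deriv u x - iteratedDeriv 3 u x = 0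

/-- `u 0, u 1, u 2` form a fundamental system for `(1 + γ) u + x u' - u''' = 0`: they are linearly
independent and the solutions are exactly their linear combinations. -/
def IsFundamentalSystem (γ : ℂ) (u : Fin 3 → ℝ → ℂ) : Prop :=
  LinearIndependent ℂ u ∧
    ∀ v : ℝ → ℂ, IsSolution γ v ↔ v ∈ Submodule.span ℂ (Set.range u)

end

end GenAiry

/-
Write `L(a, y) = ∫₀^∞ σ ^ γ exp (-a σ³/3 + y σ) dσ`. Integration by parts shows that
`exp (-(γ + 1) w) L (exp (-3 w), exp (-w) y)` does not depend on `w`; this rotation of the contour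
makes `Ai_γ`, `Gi_γ`, `Hi_γ`, after the limit `ε → 0+`, explicit combinations of the three functions
`F_j(x) = ∫₀^∞ σ ^ γ exp (-σ³/3 + ω ^ j x σ) dσ`, where `ω = exp (2πi/3)`.

The `F_j` solve the differential equation and their jets at `0` are values of the Gamma function.
The Wronskian of three solutions is constant, so it may be computed at `0`, where the Gauss
multiplication formula gives a multiple of `Γ(γ + 1)`. The bracket of two solutions solves the
equation with `-1 - γ` in place of `γ`, so the bracket identities hold as soon as the jets at `0`
agree, and these are related by the reflection formula.

Integrating by parts twice shows that the improper integrals converge for `Re γ < 2`; by an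
Abelian theorem their values are those of the oscillatory integrals.
-/

namespace GenAiry

/-! ### Rotation of the contour -/

/-- The integrand of `cubicLaplace`; `a = ∓I`, `y = ±I * x` gives the two exponentials in the
oscillatory integrals of `Ai` and `Gi`, and `a = 1`, `y = x` the integrand of `Hi`. -/
noncomputable def kernel (γ a y : ℂ) (σ : ℝ) : ℂ :=
  (σ : ℂ) ^ γ * Complex.exp (-a * (σ : ℂ) ^ 3 / 3 + y * (σ : ℂ))

/-- The Laplace-type integral `∫₀^∞ σ ^ γ exp (-a σ³/3 + y σ) dσ`. It converges absolutely if
`-1 < Re γ` and either `0 < Re a`, or `0 ≤ Re a` and `Re y < 0`. -/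
noncomputable def cubicLaplace (γ a y : ℂ) : ℂ := ∫ σ in Ioi (0 : ℝ), kernel γ a y σ

lemma norm_exp_cubic (a y : ℂ) (σ : ℝ) :
    ‖Complex.exp (-a * (σ : ℂ) ^ 3 / 3 + y * σ)‖ =
      Real.exp (-a.re * σ ^ 3 / 3 + y.re * σ) := by
  have h : -a * (σ : ℂ) ^ 3 / 3 + y * σ = -a * ((σ ^ 3 / 3 : ℝ) : ℂ) + y * σ := by
    push_cast; ring
  rw [Complex.norm_exp, h, Complex.add_re, Complex.re_mul_ofReal, Complex.re_mul_ofReal,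
    Complex.neg_re, mul_div_assoc]

lemma norm_kernel (γ a y : ℂ) {σ : ℝ} (hσ : 0 < σ) :
    ‖kernel γ a y σ‖ = σ ^ γ.re * Real.exp (-a.re * σ ^ 3 / 3 + y.re * σ) := by
  rw [kernel, norm_mul, Complex.norm_cpow_eq_rpow_re_of_pos hσ, norm_exp_cubic]

lemma norm_kernel_le_norm_kernel (γ : ℂ) {a b y z : ℂ} (hab : b.re ≤ a.re) (hyz : y.re ≤ z.re)
    {σ : ℝ} (hσ : 0 < σ) : ‖kernel γ a y σ‖ ≤ ‖kernel γ b z σ‖ := by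
  rw [norm_kernel γ a y hσ, norm_kernel γ b z hσ]
  gcongr

lemma continuousOn_kernel (γ a y : ℂ) : ContinuousOn (kernel γ a y) (Ioi 0) :=
  ContinuousOn.mul (fun _ hσ => (Complex.continuousAt_ofReal_cpow_const _ _
    (Or.inr (ne_of_gt hσ))).continuousWithinAt) (by fun_prop)

lemma continuous_kernel {γ : ℂ} (hγ : 0 < γ.re) (a y : ℂ) : Continuous (kernel γ a y) :=
  (Complex.continuous_ofReal_cpow_const hγ).mul (by fun_prop)

lemma aestronglyMeasurable_kernel (γ a y : ℂ) :
    AEStronglyMeasurable (kernel γ a y) (volume.restrict (Ioi 0)) :=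
  (continuousOn_kernel γ a y).aestronglyMeasurable measurableSet_Ioi

lemma integrableOn_kernel_of_eventually_le {γ a y : ℂ} (hγ : -1 < γ.re) {b : ℝ} (hb : 0 < b)
    (h : ∀ᶠ σ : ℝ in atTop, -a.re * σ ^ 3 / 3 + y.re * σ ≤ -b * σ) :
    IntegrableOn (kernel γ a y) (Ioi 0) := by
  have hf : Continuous fun σ : ℝ => Complex.exp (-a * (σ : ℂ) ^ 3 / 3 + y * σ) := by fun_prop
  have htop : (fun σ : ℝ => Complex.exp (-a * (σ : ℂ) ^ 3 / 3 + y * σ)) =O[atTop]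
      fun σ => Real.exp (-b * σ) :=
    .of_bound 1 <| by
      filter_upwards [h] with σ hσ
      rwa [norm_exp_cubic, Real.norm_of_nonneg (Real.exp_nonneg _), one_mul, Real.exp_le_exp]
  have hbot : (fun σ : ℝ => Complex.exp (-a * (σ : ℂ) ^ 3 / 3 + y * σ)) =O[𝓝[>] 0]
      fun σ : ℝ => σ ^ (-0 : ℝ) := by
    simpa using (hf.tendsto 0).mono_left nhdsWithin_le_nhds |>.isBigO_one ℝ
  have h := mellinConvergent_of_isBigO_rpow_exp hb (s := γ + 1)
    (hf.locallyIntegrable.locallyIntegrableOn _) htop hbot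
    (by rw [Complex.add_re, Complex.one_re]; linarith)
  rwa [MellinConvergent, add_sub_cancel_right] at h

lemma integrableOn_kernel {γ a : ℂ} (hγ : -1 < γ.re) (ha : 0 < a.re) (y : ℂ) :
    IntegrableOn (kernel γ a y) (Ioi 0) := by
  refine integrableOn_kernel_of_eventually_le hγ one_pos ?_
  filter_upwards [(tendsto_pow_atTop two_ne_zero).eventually_ge_atTop (3 * (y.re + 1) / a.re),
    eventually_ge_atTop 0] with σ hσ hσ0
  rw [div_le_iff₀ ha] at hσ
  nlinarith

lemma integrableOn_kernel_of_re_neg {γ a y : ℂ} (hγ : -1 < γ.re) (ha : 0 ≤ a.re)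
    (hy : y.re < 0) : IntegrableOn (kernel γ a y) (Ioi 0) := by
  refine integrableOn_kernel_of_eventually_le hγ (neg_pos.2 hy) ?_
  filter_upwards [eventually_ge_atTop 0] with σ hσ
  have : 0 ≤ a.re * σ ^ 3 := by positivity
  linarith

lemma neg_one_lt_re_add {γ : ℂ} (hγ : -1 < γ.re) {z : ℂ} (hz : 0 ≤ z.re) : -1 < (γ + z).re := by
  rw [Complex.add_re]
  linarith

lemma kernel_add_one (γ a y : ℂ) {σ : ℝ} (hσ : 0 < σ) :
    kernel (γ + 1) a y σ = σ * kernel γ a y σ := by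
  have : (σ : ℂ) ≠ 0 := by exact_mod_cast hσ.ne'
  rw [kernel, kernel, Complex.cpow_add _ _ this, Complex.cpow_one]
  ring

lemma kernel_add_three (γ a y : ℂ) {σ : ℝ} (hσ : 0 < σ) :
    kernel (γ + 3) a y σ = σ ^ 3 * kernel γ a y σ := by
  have h : γ + 3 = γ + 1 + 1 + 1 := by ring
  rw [h, kernel_add_one _ _ _ hσ, kernel_add_one _ _ _ hσ, kernel_add_one _ _ _ hσ]
  ring

lemma hasDerivAt_kernel (γ a y : ℂ) {σ : ℝ} (hσ : 0 < σ) :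
    HasDerivAt (kernel (γ + 1) a y)
      ((γ + 1) * kernel γ a y σ - a * kernel (γ + 3) a y σ + y * kernel (γ + 1) a y σ) σ := by
  have hpow : HasDerivAt (fun z : ℂ => z ^ (γ + 1)) ((γ + 1) * (σ : ℂ) ^ γ) σ := by
    simpa using (hasDerivAt_id (σ : ℂ)).cpow_const (c := γ + 1)
      (Complex.ofReal_mem_slitPlane.2 hσ)
  have hexp : HasDerivAt (fun z : ℂ => -a * z ^ 3 / 3 + y * z) (-a * (σ : ℂ) ^ 2 + y) σ :=
    ((((hasDerivAt_pow 3 (σ : ℂ)).const_mul (-a)).div_const 3).add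
      ((hasDerivAt_id (σ : ℂ)).const_mul y)).congr_deriv (by push_cast; ring)
  refine (hpow.mul hexp.cexp).comp_ofReal.congr_deriv ?_
  have h := kernel_add_one γ a y hσ
  rw [kernel_add_three _ _ _ hσ]
  simp only [kernel] at h ⊢
  linear_combination (-a * σ ^ 2) * h

lemma cubicLaplace_add_three {γ a : ℂ} (hγ : -1 < γ.re) (ha : 0 < a.re) (y : ℂ) :
    a * cubicLaplace (γ + 3) a y = (γ + 1) * cubicLaplace γ a y + y * cubicLaplace (γ + 1) a y := by
  have hγ₁ : 0 < (γ + 1).re := by rw [Complex.add_re, Complex.one_re]; linarith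
  have i₀ := integrableOn_kernel hγ ha y
  have i₁ := integrableOn_kernel (γ := γ + 1) (by linarith) ha y
  have i₃ := integrableOn_kernel (neg_one_lt_re_add hγ (z := 3) (by simp)) ha y
  have hd : ∀ σ ∈ Ioi (0 : ℝ), HasDerivAt (kernel (γ + 1) a y) _ σ :=
    fun σ hσ => hasDerivAt_kernel γ a y hσ
  have hi := ((i₀.const_mul (γ + 1)).sub (i₃.const_mul a)).add (i₁.const_mul y)
  have h₀ : kernel (γ + 1) a y 0 = 0 := by
    rw [kernel, Complex.ofReal_zero, Complex.zero_cpow (fun h => hγ₁.ne' (by simp [h])), zero_mul]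
  have key := integral_Ioi_of_hasDerivAt_of_tendsto
    (continuous_kernel hγ₁ a y).continuousWithinAt hd hi
    (tendsto_zero_of_hasDerivAt_of_integrableOn_Ioi hd hi i₁)
  rw [integral_add (by exact (i₀.const_mul _).sub (i₃.const_mul _)) (i₁.const_mul _),
    integral_sub (i₀.const_mul _) (i₃.const_mul _), integral_const_mul, integral_const_mul,
    integral_const_mul, h₀] at key
  simp only [cubicLaplace]
  linear_combination -key

lemma hasDerivAt_kernel_comp (γ : ℂ) {a y : ℂ → ℂ} {a' y' w : ℂ} (ha : HasDerivAt a a' w)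
    (hy : HasDerivAt y y' w) {σ : ℝ} (hσ : 0 < σ) :
    HasDerivAt (fun w => kernel γ (a w) (y w) σ)
      (-a' / 3 * kernel (γ + 3) (a w) (y w) σ + y' * kernel (γ + 1) (a w) (y w) σ) w := by
  have h := (((ha.neg.mul_const ((σ : ℂ) ^ 3)).div_const 3).add
    (hy.mul_const (σ : ℂ))).cexp.const_mul ((σ : ℂ) ^ γ)
  refine h.congr_deriv ?_
  rw [kernel_add_three _ _ _ hσ, kernel_add_one _ _ _ hσ, kernel]
  simp only [Pi.add_apply, Pi.neg_apply]
  ring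

lemma hasDerivAt_cubicLaplace_comp {γ : ℂ} (hγ : -1 < γ.re) {a y : ℂ → ℂ}
    (ha : Differentiable ℂ a) (hy : Differentiable ℂ y) {w : ℂ} (haw : 0 < (a w).re) :
    HasDerivAt (fun w => cubicLaplace γ (a w) (y w))
      (-deriv a w / 3 * cubicLaplace (γ + 3) (a w) (y w) +
        deriv y w * cubicLaplace (γ + 1) (a w) (y w)) w := by
  have hγ₁ : -1 < (γ + 1).re := neg_one_lt_re_add hγ (by simp)
  have hγ₃ : -1 < (γ + 3).re := neg_one_lt_re_add hγ (by simp)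
  have hca : Continuous (deriv a) := ha.contDiff.continuous_deriv one_le_two
  have hcy : Continuous (deriv y) := hy.contDiff.continuous_deriv one_le_two
  -- near `w` both terms of the derivative are dominated by kernels with fixed parameters `c`, `b`
  set c : ℂ := (((a w).re / 2 : ℝ) : ℂ)
  set b : ℂ := (((y w).re + 1 : ℝ) : ℂ)
  have hc : 0 < c.re := by simpa [c] using haw
  have hs : ∀ᶠ z in 𝓝 w, c.re ≤ (a z).re ∧ (y z).re ≤ b.re ∧
      ‖-deriv a z / 3‖ ≤ ‖-deriv a w / 3‖ + 1 ∧ ‖deriv y z‖ ≤ ‖deriv y w‖ + 1 := by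
    have h₁ : ContinuousAt (fun z => (a z).re) w := by have := ha.continuous; fun_prop
    have h₂ : ContinuousAt (fun z => (y z).re) w := by have := hy.continuous; fun_prop
    have h₃ : ContinuousAt (fun z => ‖-deriv a z / 3‖) w := by fun_prop
    have h₄ : ContinuousAt (fun z => ‖deriv y z‖) w := by fun_prop
    exact (h₁.eventually_const_le (by simpa [c] using haw)).and <|
      (h₂.eventually_le_const (by simp [b])).and <|
      (h₃.eventually_le_const (lt_add_one _)).and (h₄.eventually_le_const (lt_add_one _))
  have key := (hasDerivAt_integral_of_dominated_loc_of_deriv_le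
    (F := fun z σ => kernel γ (a z) (y z) σ) (μ := volume.restrict (Ioi 0)) hs
    (.of_forall fun z => aestronglyMeasurable_kernel _ _ _) (integrableOn_kernel hγ haw (y w))
    (((aestronglyMeasurable_kernel _ _ _).const_mul _).add
      ((aestronglyMeasurable_kernel _ _ _).const_mul _))
    (bound := fun σ => (‖-deriv a w / 3‖ + 1) * ‖kernel (γ + 3) c b σ‖ +
      (‖deriv y w‖ + 1) * ‖kernel (γ + 1) c b σ‖) ?_
    (((integrableOn_kernel hγ₃ hc b).norm.const_mul _).add
      ((integrableOn_kernel hγ₁ hc b).norm.const_mul _))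
    ((ae_restrict_iff' measurableSet_Ioi).2 <| .of_forall fun σ hσ z _ =>
      hasDerivAt_kernel_comp γ (ha z).hasDerivAt (hy z).hasDerivAt hσ)).2
  · rwa [integral_add ((integrableOn_kernel hγ₃ haw _).const_mul _)
      ((integrableOn_kernel hγ₁ haw _).const_mul _), integral_const_mul, integral_const_mul] at key
  · refine (ae_restrict_iff' measurableSet_Ioi).2 (.of_forall fun σ hσ z hz => ?_)
    obtain ⟨h₁, h₂, h₃, h₄⟩ := hz
    refine (norm_add_le _ _).trans ?_
    rw [norm_mul, norm_mul]
    gcongr <;> exact norm_kernel_le_norm_kernel _ h₁ h₂ hσ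

lemma differentiable_cubicLaplace_one {γ : ℂ} (hγ : -1 < γ.re) :
    Differentiable ℂ (cubicLaplace γ 1) := fun y =>
  (hasDerivAt_cubicLaplace_comp (a := fun _ => 1) (w := y) hγ (differentiable_const 1)
    differentiable_id one_pos).differentiableAt

-- Along `w ↦ (exp (-3 w), exp (-w) y)` the derivative of the Laplace integral is
-- `(γ + 1)` times the integral, by `cubicLaplace_add_three`.
lemma hasDerivAt_exp_mul_cubicLaplace {γ : ℂ} (hγ : -1 < γ.re) (y : ℂ) {w : ℂ}
    (hw : 0 < (Complex.exp (-3 * w)).re) :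
    HasDerivAt (fun w => Complex.exp (-(γ + 1) * w) *
      cubicLaplace γ (Complex.exp (-3 * w)) (Complex.exp (-w) * y)) 0 w := by
  have ha : Differentiable ℂ fun w => Complex.exp (-3 * w) := by fun_prop
  have hy : Differentiable ℂ fun w => Complex.exp (-w) * y := by fun_prop
  have hexp (c : ℂ) : HasDerivAt (fun w => Complex.exp (c * w)) (c * Complex.exp (c * w)) w := by
    simpa [mul_comm] using ((hasDerivAt_id w).const_mul c).cexp
  have ha' := (hexp (-3)).deriv
  have hy' : deriv (fun w => Complex.exp (-w) * y) w = -(Complex.exp (-w) * y) := by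
    simpa [neg_one_mul] using ((hexp (-1)).mul_const y).deriv
  have h := (hexp (-(γ + 1))).mul (hasDerivAt_cubicLaplace_comp hγ ha hy hw)
  refine h.congr_deriv ?_
  rw [ha', hy']
  linear_combination Complex.exp (-(γ + 1) * w) *
    cubicLaplace_add_three hγ hw (Complex.exp (-w) * y)

lemma exp_neg_three_mul_re_pos {w : ℂ} (hw : |w.im| < Real.pi / 6) :
    0 < (Complex.exp (-3 * w)).re := by
  rw [Complex.exp_re]
  refine mul_pos (Real.exp_pos _) (Real.cos_pos_of_mem_Ioo ?_)
  have him : (-3 * w).im = -3 * w.im := by simp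
  rw [abs_lt] at hw
  rw [him]
  constructor <;> linarith

lemma exp_neg_three_mul_re_nonneg {w : ℂ} (hw : |w.im| ≤ Real.pi / 6) :
    0 ≤ (Complex.exp (-3 * w)).re := by
  rw [Complex.exp_re]
  refine mul_nonneg (Real.exp_nonneg _) (Real.cos_nonneg_of_mem_Icc ?_)
  have him : (-3 * w).im = -3 * w.im := by simp
  rw [abs_le] at hw
  rw [him]
  constructor <;> linarith

lemma cubicLaplace_exp_of_abs_im_lt {γ : ℂ} (hγ : -1 < γ.re) (y : ℂ) {w : ℂ}
    (hw : |w.im| < Real.pi / 6) :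
    cubicLaplace γ (Complex.exp (-3 * w)) y =
      Complex.exp ((γ + 1) * w) * cubicLaplace γ 1 (Complex.exp w * y) := by
  set S : Set ℂ := Complex.im ⁻¹' Ioo (-(Real.pi / 6)) (Real.pi / 6)
  have hS : IsOpen S := isOpen_Ioo.preimage Complex.continuous_im
  have hS' : IsPreconnected S :=
    ((convex_Ioo (-(Real.pi / 6)) (Real.pi / 6)).linear_preimage Complex.imLm).isPreconnected
  have hd (z : ℂ) (hz : z ∈ S) :=
    hasDerivAt_exp_mul_cubicLaplace hγ (Complex.exp w * y) (exp_neg_three_mul_re_pos (abs_lt.2 hz))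
  have hconst := hS.is_const_of_deriv_eq_zero hS'
    (fun z hz => (hd z hz).differentiableAt.differentiableWithinAt) (fun z hz => (hd z hz).deriv)
    (abs_lt.1 hw : w ∈ S) (by simp [S, Real.pi_pos] : (0 : ℂ) ∈ S)
  have hcancel : Complex.exp (-w) * (Complex.exp w * y) = y := by
    rw [← mul_assoc, ← Complex.exp_add, neg_add_cancel, Complex.exp_zero, one_mul]
  simp only [hcancel, mul_zero, neg_zero, Complex.exp_zero, one_mul] at hconst
  rw [← hconst, ← mul_assoc, ← Complex.exp_add, ← add_mul, add_neg_cancel, zero_mul,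
    Complex.exp_zero, one_mul]

-- The limiting case of the previous lemma is approached along `t * w` as `t → 1-`.
lemma cubicLaplace_exp_of_abs_im_le {γ : ℂ} (hγ : -1 < γ.re) {y : ℂ} (hy : y.re < 0) {w : ℂ}
    (hw : |w.im| ≤ Real.pi / 6) :
    cubicLaplace γ (Complex.exp (-3 * w)) y =
      Complex.exp ((γ + 1) * w) * cubicLaplace γ 1 (Complex.exp w * y) := by
  have him (t : ℝ) : (t * w).im = t * w.im := Complex.im_ofReal_mul t w
  have hnear : ∀ᶠ t : ℝ in 𝓝[<] 1, t ∈ Ioo 0 1 := Ioo_mem_nhdsLT one_pos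
  have hleft : Tendsto (fun t : ℝ => cubicLaplace γ (Complex.exp (-3 * (t * w))) y) (𝓝[<] 1)
      (𝓝 (cubicLaplace γ (Complex.exp (-3 * w)) y)) := by
    refine tendsto_integral_filter_of_dominated_convergence (fun σ => ‖kernel γ 0 y σ‖)
      (.of_forall fun t => aestronglyMeasurable_kernel _ _ _) ?_
      (integrableOn_kernel_of_re_neg hγ le_rfl hy).norm (.of_forall fun σ => ?_)
    · filter_upwards [hnear] with t ht
      refine (ae_restrict_iff' measurableSet_Ioi).2 (.of_forall fun σ hσ => ?_)
      refine norm_kernel_le_norm_kernel γ (exp_neg_three_mul_re_nonneg ?_) le_rfl hσ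
      rw [him, abs_mul, abs_of_pos ht.1]
      exact (mul_le_of_le_one_left (abs_nonneg _) ht.2.le).trans hw
    · have hcont : Continuous fun t : ℝ => kernel γ (Complex.exp (-3 * (t * w))) y σ := by
        unfold kernel; fun_prop
      simpa using (hcont.tendsto 1).mono_left nhdsWithin_le_nhds
  have hright : Tendsto (fun t : ℝ => Complex.exp ((γ + 1) * (t * w)) *
      cubicLaplace γ 1 (Complex.exp (t * w) * y)) (𝓝[<] 1)
      (𝓝 (Complex.exp ((γ + 1) * w) * cubicLaplace γ 1 (Complex.exp w * y))) := by
    have hL := (differentiable_cubicLaplace_one hγ).continuous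
    have hcont : Continuous fun t : ℝ => Complex.exp ((γ + 1) * (t * w)) *
      cubicLaplace γ 1 (Complex.exp (t * w) * y) := by fun_prop
    simpa using (hcont.tendsto 1).mono_left nhdsWithin_le_nhds
  refine tendsto_nhds_unique hleft (hright.congr' ?_)
  filter_upwards [hnear] with t ht
  refine (cubicLaplace_exp_of_abs_im_lt hγ y ?_).symm
  rw [him, abs_mul, abs_of_pos ht.1]
  nlinarith [ht.1, ht.2, abs_nonneg w.im, Real.pi_pos]

/-! ### The multiplication formula for the Gamma function -/

lemma prod_Gamma_add_one_div {n : ℕ} (hn : n ≠ 0) {s : ℝ} (hs : 0 < s) :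
    ∏ k ∈ Finset.range n, Real.Gamma ((s + 1 + k) / n) =
      s / n * ∏ k ∈ Finset.range n, Real.Gamma ((s + k) / n) := by
  have hn' : (n : ℝ) ≠ 0 := Nat.cast_ne_zero.2 hn
  have hstep : Real.Gamma ((s + n) / n) = s / n * Real.Gamma (s / n) := by
    rw [add_div, div_self hn', Real.Gamma_add_one (div_ne_zero hs.ne' hn')]
  have hΓ : Real.Gamma (s / n) ≠ 0 := (Real.Gamma_pos_of_pos (by positivity)).ne'
  have hprod := (Finset.prod_range_succ' (fun k : ℕ => Real.Gamma ((s + k) / n)) n).symm.trans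
    (Finset.prod_range_succ (fun k : ℕ => Real.Gamma ((s + k) / n)) n)
  simp only [Nat.cast_add, Nat.cast_one, Nat.cast_zero, add_zero, hstep] at hprod
  refine mul_right_cancel₀ hΓ ?_
  simp only [add_assoc, add_comm (1 : ℝ)]
  linear_combination hprod

lemma convexOn_log_Gamma_add_div {n : ℕ} (hn : n ≠ 0) (k : ℕ) :
    ConvexOn ℝ (Ioi (0 : ℝ)) fun s : ℝ => Real.log (Real.Gamma ((s + k) / n)) := by
  have : (0 : ℝ) < n := Nat.cast_pos.2 hn.bot_lt
  have h := Real.convexOn_log_Gamma.comp_affineMap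
    (AffineMap.lineMap ((k : ℝ) / n) (((1 : ℝ) + k) / n))
  refine (h.subset (fun s (hs : 0 < s) => ?_) (convex_Ioi 0)).congr fun s _ => ?_
  · simp only [mem_preimage, mem_Ioi, AffineMap.lineMap_apply_ring']
    have hline : s * ((1 + k) / n - k / n) + k / n = (s + k) / n := by ring
    rw [hline]
    positivity
  · simp only [Function.comp_apply, AffineMap.lineMap_apply_ring']
    congr 2
    ring

theorem prod_Gamma_add_div {n : ℕ} (hn : n ≠ 0) {s : ℝ} (hs : 0 < s) :
    ∏ k ∈ Finset.range n, Real.Gamma ((s + k) / n) =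
      (n : ℝ) ^ (1 - s) * (∏ k ∈ Finset.range n, Real.Gamma ((1 + k) / n)) * Real.Gamma s := by
  have hn' : (0 : ℝ) < n := Nat.cast_pos.2 hn.bot_lt
  set P : ℝ → ℝ := fun s => ∏ k ∈ Finset.range n, Real.Gamma ((s + k) / n)
  have hΓ {s : ℝ} (hs : 0 < s) (k : ℕ) : 0 < Real.Gamma ((s + k) / n) :=
    Real.Gamma_pos_of_pos (by positivity)
  have hP {s : ℝ} (hs : 0 < s) : 0 < P s := Finset.prod_pos fun k _ => hΓ hs k
  have hpow (s : ℝ) : 0 < (n : ℝ) ^ (s - 1) := Real.rpow_pos_of_pos hn' _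
  have hconv : ConvexOn ℝ (Ioi 0) (Real.log ∘ fun s => (n : ℝ) ^ (s - 1) * P s / P 1) := by
    have hsum : ConvexOn ℝ (Ioi (0 : ℝ))
        (∑ k ∈ Finset.range n, fun s : ℝ => Real.log (Real.Gamma ((s + k) / n))) :=
      Finset.sum_induction _ (ConvexOn ℝ (Ioi 0)) (fun _ _ => ConvexOn.add)
        (convexOn_const 0 (convex_Ioi 0)) fun k _ => convexOn_log_Gamma_add_div hn k
    have hlin : ConvexOn ℝ (Ioi (0 : ℝ)) fun s => Real.log n * s :=
      (convexOn_id (convex_Ioi 0)).smul (Real.log_natCast_nonneg n)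
    refine ((hlin.add hsum).add_const (-Real.log n - Real.log (P 1))).congr fun s hs => ?_
    have hlogP : Real.log (P s) = ∑ k ∈ Finset.range n, Real.log (Real.Gamma ((s + k) / n)) :=
      Real.log_prod fun k _ => (hΓ hs k).ne'
    simp only [Function.comp_apply, Pi.add_apply, Finset.sum_apply]
    rw [Real.log_div (mul_pos (hpow s) (hP hs)).ne' (hP one_pos).ne',
      Real.log_mul (hpow s).ne' (hP hs).ne', Real.log_rpow hn', hlogP]
    ring
  have key : (n : ℝ) ^ (s - 1) * P s / P 1 = Real.Gamma s := by
    refine Real.eq_Gamma_of_log_convex hconv (fun {s} hs => ?_)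
      (fun {s} hs => div_pos (mul_pos (hpow s) (hP hs)) (hP one_pos)) ?_ hs
    · simp only [P, prod_Gamma_add_one_div hn hs]
      rw [add_sub_right_comm, Real.rpow_add_one hn'.ne']
      field_simp
    · simp [(hP one_pos).ne']
  have hinv : (n : ℝ) ^ (1 - s) * (n : ℝ) ^ (s - 1) = 1 := by
    rw [← Real.rpow_add hn', sub_add_sub_cancel', sub_self, Real.rpow_zero]
  rw [← key, mul_assoc, mul_div_cancel₀ _ (hP one_pos).ne', ← mul_assoc, hinv, one_mul]

theorem prod_complexGamma_add_div {n : ℕ} (hn : n ≠ 0) (s : ℂ) :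
    ∏ k ∈ Finset.range n, Complex.Gamma ((s + k) / n) =
      (n : ℂ) ^ (1 - s) * (∏ k ∈ Finset.range n, Complex.Gamma ((1 + k) / n)) *
        Complex.Gamma s := by
  have hn' : (n : ℂ) ≠ 0 := Nat.cast_ne_zero.2 hn
  have hl : Differentiable ℂ fun s : ℂ => ∏ k ∈ Finset.range n, (Complex.Gamma ((s + k) / n))⁻¹ :=
    Differentiable.fun_finsetProd fun k _ =>
      Complex.differentiable_one_div_Gamma.comp (by fun_prop)
  have hr : Differentiable ℂ fun s : ℂ => ((n : ℂ) ^ (1 - s))⁻¹ *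
      (∏ k ∈ Finset.range n, (Complex.Gamma ((1 + k) / n))⁻¹) * (Complex.Gamma s)⁻¹ := by
    refine Differentiable.mul (Differentiable.mul_const ?_ _) Complex.differentiable_one_div_Gamma
    exact Differentiable.inv (Differentiable.const_cpow (by fun_prop) (.inl hn'))
      fun s => by simp [Complex.cpow_eq_zero_iff, hn']
  have hreal : ∀ᶠ x : ℝ in 𝓝[≠] 1, ∏ k ∈ Finset.range n, (Complex.Gamma (((x : ℂ) + k) / n))⁻¹ =
      ((n : ℂ) ^ (1 - (x : ℂ)))⁻¹ * (∏ k ∈ Finset.range n, (Complex.Gamma ((1 + k) / n))⁻¹) *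
        (Complex.Gamma x)⁻¹ := by
    filter_upwards [nhdsWithin_le_nhds (eventually_gt_nhds zero_lt_one)] with x hx
    have h := congrArg Complex.ofReal (prod_Gamma_add_div hn hx)
    push_cast [Complex.ofReal_cpow n.cast_nonneg] at h
    simp only [← Complex.Gamma_ofReal] at h
    push_cast at h
    rw [Finset.prod_inv_distrib, Finset.prod_inv_distrib, h, mul_inv, mul_inv]
  have hlim : Tendsto ((↑) : ℝ → ℂ) (𝓝[≠] 1) (𝓝[≠] ((1 : ℝ) : ℂ)) :=
    tendsto_nhdsWithin_iff.2 ⟨Complex.continuous_ofReal.continuousAt.mono_left nhdsWithin_le_nhds,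
      eventually_nhdsWithin_of_forall fun x hx => Complex.ofReal_injective.ne hx⟩
  have h := AnalyticOnNhd.eq_of_frequently_eq (fun z _ => hl.analyticAt z)
    (fun z _ => hr.analyticAt z) (hlim.frequently hreal.frequently)
  simpa only [Finset.prod_inv_distrib, ← mul_inv, inv_inv] using congrArg (·⁻¹) (congrFun h s)

/-! ### Moments of `exp (-σ³/3)` -/

/-- The primitive cube root of unity `exp (2 π i / 3)`. -/
noncomputable def ω : ℂ := Complex.exp (2 * Real.pi * Complex.I / 3)

lemma ω_pow_three : ω ^ 3 = 1 := (Complex.isPrimitiveRoot_exp 3 three_ne_zero).pow_eq_one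

lemma ω_pow_val_add (j k : Fin 3) :
    ω ^ ((j + k : Fin 3) : ℕ) = ω ^ (j : ℕ) * ω ^ (k : ℕ) := by
  rw [Fin.val_add, ← pow_eq_pow_mod _ ω_pow_three, pow_add]

lemma inv_ω : ω⁻¹ = ω ^ 2 :=
  inv_eq_of_mul_eq_one_right (by linear_combination ω_pow_three)

lemma inv_ω_sq : (ω ^ 2)⁻¹ = ω := by rw [← inv_ω, inv_inv]

lemma exp_pi_div_three_mul_I : Complex.exp (Real.pi / 3 * Complex.I) = -ω ^ 2 := by
  rw [ω, ← Complex.exp_nat_mul, neg_eq_neg_one_mul, ← Complex.exp_pi_mul_I, ← Complex.exp_add,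
    Complex.exp_eq_exp_iff_exists_int]
  exact ⟨-1, by push_cast; ring⟩

/-- The moment `∫₀^∞ σ ^ γ exp (-σ³/3) dσ`; the `k`-th derivative of `cubicLaplace γ 1` at `0` is
`cubicMoment (γ + k)`. -/
noncomputable def cubicMoment (γ : ℂ) : ℂ := cubicLaplace γ 1 0

lemma cubicMoment_eq_Gamma {γ : ℂ} (hγ : -1 < γ.re) :
    cubicMoment γ = 3 ^ ((γ + 1) / 3 - 1) * Complex.Gamma ((γ + 1) / 3) := by
  have hre : 0 < ((γ + 1) / 3).re := by
    rw [Complex.div_ofNat_re, Complex.add_re, Complex.one_re]; linarith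
  have hmellin : cubicMoment γ =
      mellin (fun t : ℝ => (Real.exp (-(3⁻¹ * t ^ (3 : ℝ))) : ℂ)) (γ + 1) := by
    refine setIntegral_congr_fun measurableSet_Ioi fun σ _ => ?_
    simp only [kernel, add_sub_cancel_right, smul_eq_mul, Complex.ofReal_exp, Real.rpow_ofNat]
    push_cast
    ring_nf
  have hpow : ((3⁻¹ : ℝ) : ℂ) ^ (-((γ + 1) / 3)) = 3 ^ ((γ + 1) / 3) := by
    rw [Complex.ofReal_inv, Complex.cpow_neg, Complex.inv_cpow _ _ (by
      rw [Complex.arg_ofReal_of_nonneg (by norm_num)]; exact Real.pi_ne_zero.symm), inv_inv,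
      Complex.ofReal_ofNat]
  have hrpow := mellin_comp_rpow (fun t : ℝ => (Real.exp (-(3⁻¹ * t)) : ℂ)) (γ + 1) 3
  have hmul := mellin_comp_mul_left (fun t : ℝ => (Real.exp (-t) : ℂ)) ((γ + 1) / 3)
    (a := 3⁻¹) (by norm_num)
  rw [hmellin, hrpow, Complex.ofReal_ofNat, hmul, ← Complex.GammaIntegral_eq_mellin,
    ← Complex.Gamma_eq_integral hre, hpow, Complex.cpow_sub _ _ three_ne_zero, Complex.cpow_one,
    Nat.abs_ofNat, Complex.real_smul, smul_eq_mul]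
  push_cast
  ring

lemma cubicMoment_ne_zero {γ : ℂ} (hγ : -1 < γ.re) : cubicMoment γ ≠ 0 := by
  rw [cubicMoment_eq_Gamma hγ]
  refine mul_ne_zero (by simp [Complex.cpow_eq_zero_iff]) (Complex.Gamma_ne_zero_of_re_pos ?_)
  rw [Complex.div_ofNat_re, Complex.add_re, Complex.one_re]
  linarith

lemma Gamma_mul_Gamma_one_sub_mul_exp_sub_exp {z : ℂ} (h₀ : 0 < z.re) (h₁ : z.re < 1) :
    Complex.Gamma z * Complex.Gamma (1 - z) *
      (Complex.exp (Real.pi * z * Complex.I) - Complex.exp (-(Real.pi * z * Complex.I))) =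
        2 * Real.pi * Complex.I := by
  have hΓ : Complex.Gamma z * Complex.Gamma (1 - z) ≠ 0 :=
    mul_ne_zero (Complex.Gamma_ne_zero_of_re_pos h₀)
      (Complex.Gamma_ne_zero_of_re_pos (by rw [Complex.sub_re, Complex.one_re]; linarith))
  have hreflect := Complex.Gamma_mul_Gamma_one_sub z
  have hsin : Complex.sin (Real.pi * z) ≠ 0 := fun h => hΓ (by rw [hreflect, h, div_zero])
  have hexp := Complex.two_sin (Real.pi * z)
  rw [neg_mul] at hexp
  rw [eq_div_iff hsin] at hreflect
  linear_combination 2 * Complex.I * hreflect - Complex.Gamma z * Complex.Gamma (1 - z) *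
    (Complex.I * hexp - (Complex.exp (Real.pi * z * Complex.I) -
      Complex.exp (-(Real.pi * z * Complex.I))) * Complex.I_sq)

lemma cubicMoment_mul_cubicMoment_one_sub {β : ℂ} (h₁ : -1 < β.re) (h₂ : β.re < 2) :
    3 * (cubicMoment β * cubicMoment (1 - β)) *
      (Complex.exp (Real.pi * ((β + 1) / 3) * Complex.I) -
        Complex.exp (-(Real.pi * ((β + 1) / 3) * Complex.I))) = 2 * Real.pi * Complex.I := by
  have hre : ((β + 1) / 3).re = (β.re + 1) / 3 := by
    rw [Complex.div_ofNat_re, Complex.add_re, Complex.one_re]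
  have hΓ := Gamma_mul_Gamma_one_sub_mul_exp_sub_exp (z := (β + 1) / 3)
    (by rw [hre]; linarith) (by rw [hre]; linarith)
  have hβ : (1 - β + 1) / 3 = 1 - (β + 1) / 3 := by ring
  have hpow : (3 : ℂ) ^ ((β + 1) / 3 - 1) * 3 ^ (1 - (β + 1) / 3 - 1) = 3⁻¹ := by
    rw [← Complex.cpow_add _ _ three_ne_zero, ← Complex.cpow_neg_one]
    ring_nf
  rw [cubicMoment_eq_Gamma h₁, cubicMoment_eq_Gamma (γ := 1 - β)
    (by rw [Complex.sub_re, Complex.one_re]; linarith), hβ]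
  linear_combination hΓ + 3 * Complex.Gamma ((β + 1) / 3) * Complex.Gamma (1 - (β + 1) / 3) *
    (Complex.exp (Real.pi * ((β + 1) / 3) * Complex.I) -
        Complex.exp (-(Real.pi * ((β + 1) / 3) * Complex.I))) * hpow

lemma Gamma_one_third_mul_Gamma_two_thirds :
    Complex.Gamma (1 / 3) * Complex.Gamma (2 / 3) * (ω - ω ^ 2) = 2 * Real.pi * Complex.I := by
  have hΓ := Gamma_mul_Gamma_one_sub_mul_exp_sub_exp (z := 1 / 3) (by norm_num) (by norm_num)
  have hexp : Complex.exp (Real.pi * (1 / 3) * Complex.I) = -ω ^ 2 := by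
    rw [← exp_pi_div_three_mul_I, mul_one_div]
  have hinv : (-ω ^ 2)⁻¹ = -ω := by rw [inv_neg, inv_ω_sq]
  have hsub : (1 : ℂ) - 1 / 3 = 2 / 3 := by norm_num
  rw [Complex.exp_neg, hexp, hinv, hsub] at hΓ
  linear_combination hΓ

lemma cubicMoment_prod {γ : ℂ} (hγ : -1 < γ.re) :
    3 * (ω - ω ^ 2) * (cubicMoment γ * cubicMoment (γ + 1) * cubicMoment (γ + 2)) =
      2 * Real.pi * Complex.I * Complex.Gamma (γ + 1) := by
  have hgauss := prod_complexGamma_add_div three_ne_zero (γ + 1)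
  simp only [Finset.prod_range_succ, Finset.prod_range_zero, one_mul, Nat.cast_zero, add_zero,
    Nat.cast_one, Nat.cast_ofNat] at hgauss
  have hpow : (3 : ℂ) ^ ((γ + 1) / 3 - 1) * 3 ^ ((γ + 1 + 1) / 3 - 1) * 3 ^ ((γ + 2 + 1) / 3 - 1) *
      3 ^ (1 - (γ + 1)) = 3⁻¹ := by
    simp only [← Complex.cpow_add _ _ (three_ne_zero : (3 : ℂ) ≠ 0), ← Complex.cpow_neg_one]
    ring_nf
  have h₁ := cubicMoment_eq_Gamma (neg_one_lt_re_add hγ (z := 1) (by simp))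
  have h₂ := cubicMoment_eq_Gamma (neg_one_lt_re_add hγ (z := 2) (by simp))
  have hΓ₃ : Complex.Gamma ((1 + 2) / 3) = 1 := by norm_num [Complex.Gamma_one]
  have hΓ₂ : Complex.Gamma ((1 + 1) / 3) = Complex.Gamma (2 / 3) := by norm_num
  rw [hΓ₃, hΓ₂] at hgauss
  rw [add_right_comm γ 2 1] at hpow h₂
  rw [cubicMoment_eq_Gamma hγ, h₁, h₂]
  linear_combination
    3 * (ω - ω ^ 2) * 3 ^ ((γ + 1) / 3 - 1) * 3 ^ ((γ + 1 + 1) / 3 - 1) *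
        3 ^ ((γ + 1 + 2) / 3 - 1) * hgauss +
      3 * (ω - ω ^ 2) * Complex.Gamma (1 / 3) * Complex.Gamma (2 / 3) * Complex.Gamma (γ + 1) *
        hpow +
      Complex.Gamma (γ + 1) * Gamma_one_third_mul_Gamma_two_thirds

/-! ### Brackets and Wronskians of solutions -/

section SolutionSpace

variable {γ : ℂ} {u v : ℝ → ℂ}

lemma IsSolution.hasDerivAt_iteratedDeriv (hu : IsSolution γ u) {k : ℕ} (hk : k < 3) (x : ℝ) :
    HasDerivAt (iteratedDeriv k u) (iteratedDeriv (k + 1) u x) x := by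
  rw [iteratedDeriv_succ]
  exact (hu.1.differentiable_iteratedDeriv k (by exact_mod_cast hk) x).hasDerivAt

lemma IsSolution.iteratedDeriv_three (hu : IsSolution γ u) (x : ℝ) :
    iteratedDeriv 3 u x = (1 + γ) * u x + x * deriv u x :=
  (sub_eq_zero.1 (hu.2 x)).symm

lemma isSolution_of_hasDerivAt {u₁ u₂ : ℝ → ℂ} (h₀ : ∀ x, HasDerivAt u (u₁ x) x)
    (h₁ : ∀ x, HasDerivAt u₁ (u₂ x) x)
    (h₂ : ∀ x : ℝ, HasDerivAt u₂ ((1 + γ) * u x + x * u₁ x) x) : IsSolution γ u := by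
  have hd₀ : deriv u = u₁ := funext fun x => (h₀ x).deriv
  have hd₁ : deriv u₁ = u₂ := funext fun x => (h₁ x).deriv
  have hd₂ : deriv u₂ = fun x : ℝ => (1 + γ) * u x + x * u₁ x := funext fun x => (h₂ x).deriv
  have hc₀ : Continuous u := continuous_iff_continuousAt.2 fun x => (h₀ x).continuousAt
  have hc₁ : Continuous u₁ := continuous_iff_continuousAt.2 fun x => (h₁ x).continuousAt
  refine ⟨?_, fun x => ?_⟩
  · have c₁ : ContDiff ℝ 1 u₂ :=
      contDiff_one_iff_deriv.2 ⟨fun x => (h₂ x).differentiableAt, by rw [hd₂]; fun_prop⟩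
    have c₂ : ContDiff ℝ (1 + 1) u₁ := contDiff_succ_iff_deriv.2
      ⟨fun x => (h₁ x).differentiableAt, by simp, by rwa [hd₁]⟩
    have c₃ : ContDiff ℝ (1 + 1 + 1) u := contDiff_succ_iff_deriv.2
      ⟨fun x => (h₀ x).differentiableAt, fun h => absurd h (by decide), by rwa [hd₀]⟩
    exact c₃.of_le (by norm_num)
  · rw [iteratedDeriv_succ, iteratedDeriv_succ, iteratedDeriv_one, hd₀, hd₁, hd₂, sub_self]

/-- The classical solutions of `(1 + γ) u + x u' - u''' = 0`, as a complex vector space. -/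
def solutionSpace (γ : ℂ) : Submodule ℂ (ℝ → ℂ) where
  carrier := {u | IsSolution γ u}
  zero_mem' := ⟨contDiff_const, fun x => by simp⟩
  add_mem' {u v} hu hv := ⟨hu.1.add hv.1, fun x => by
    rw [deriv_add (hu.1.differentiable (by norm_num) x) (hv.1.differentiable (by norm_num) x),
      iteratedDeriv_add hu.1.contDiffAt hv.1.contDiffAt, Pi.add_apply]
    linear_combination hu.2 x + hv.2 x⟩
  smul_mem' c u hu := ⟨hu.1.const_smul c, fun x => by
    rw [deriv_const_smul_field, iteratedDeriv_const_smul_field, Pi.smul_apply, smul_eq_mul,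
      smul_eq_mul, smul_eq_mul]
    linear_combination c * hu.2 x⟩

lemma IsSolution.hasDerivAt (hu : IsSolution γ u) (x : ℝ) : HasDerivAt u (deriv u x) x := by
  simpa using hu.hasDerivAt_iteratedDeriv (k := 0) (by norm_num) x

lemma IsSolution.hasDerivAt_deriv (hu : IsSolution γ u) (x : ℝ) :
    HasDerivAt (deriv u) (iteratedDeriv 2 u x) x := by
  simpa using hu.hasDerivAt_iteratedDeriv (k := 1) (by norm_num) x

lemma IsSolution.hasDerivAt_iteratedDeriv_two (hu : IsSolution γ u) (x : ℝ) :
    HasDerivAt (iteratedDeriv 2 u) ((1 + γ) * u x + x * deriv u x) x :=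
  hu.iteratedDeriv_three x ▸ hu.hasDerivAt_iteratedDeriv (k := 2) (by norm_num) x

lemma IsSolution.hasDerivAt_bracket (hu : IsSolution γ u) (hv : IsSolution γ v) (x : ℝ) :
    HasDerivAt (bracket u v) (u x * iteratedDeriv 2 v x - iteratedDeriv 2 u x * v x) x :=
  (((hu.hasDerivAt x).mul (hv.hasDerivAt_deriv x)).sub
    ((hu.hasDerivAt_deriv x).mul (hv.hasDerivAt x))).congr_deriv (by ring)

lemma IsSolution.hasDerivAt_deriv_bracket (hu : IsSolution γ u) (hv : IsSolution γ v) (x : ℝ) :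
    HasDerivAt (deriv (bracket u v)) (bracket (deriv u) (deriv v) x + x * bracket u v x) x := by
  have h : deriv (bracket u v) = fun x => u x * iteratedDeriv 2 v x - iteratedDeriv 2 u x * v x :=
    funext fun x => (hu.hasDerivAt_bracket hv x).deriv
  rw [h]
  refine (((hu.hasDerivAt x).mul (hv.hasDerivAt_iteratedDeriv_two x)).sub
    ((hu.hasDerivAt_iteratedDeriv_two x).mul (hv.hasDerivAt x))).congr_deriv ?_
  simp only [bracket, (hu.hasDerivAt_deriv x).deriv, (hv.hasDerivAt_deriv x).deriv]
  ring

theorem IsSolution.bracket (hu : IsSolution γ u) (hv : IsSolution γ v) :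
    IsSolution (-1 - γ) (bracket u v) := by
  have hb (x : ℝ) := (hu.hasDerivAt_bracket hv x).differentiableAt.hasDerivAt
  refine isSolution_of_hasDerivAt hb (hu.hasDerivAt_deriv_bracket hv) fun x => ?_
  have hb' : HasDerivAt (GenAiry.bracket (deriv u) (deriv v)) _ x :=
    ((hu.hasDerivAt_deriv x).mul (hv.hasDerivAt_iteratedDeriv_two x)).sub
      ((hu.hasDerivAt_iteratedDeriv_two x).mul (hv.hasDerivAt_deriv x)) |>.congr_of_eventuallyEq
      (.of_forall fun x => by
        simp only [GenAiry.bracket, (hu.hasDerivAt_deriv x).deriv, (hv.hasDerivAt_deriv x).deriv]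
        rfl)
  refine (hb'.add ((hasDerivAt_id x).ofReal_comp.mul (hb x))).congr_deriv ?_
  rw [(hu.hasDerivAt_bracket hv x).deriv]
  simp only [GenAiry.bracket, id, Complex.ofReal_one]
  ring

end SolutionSpace

section Wronskian

variable {γ : ℂ} {u : Fin 3 → ℝ → ℂ}

lemma wronskian_eq_bracket (u : Fin 3 → ℝ → ℂ) (x : ℝ) :
    wronskian u x = iteratedDeriv 2 (u 0) x * bracket (u 1) (u 2) x +
      iteratedDeriv 2 (u 1) x * bracket (u 2) (u 0) x +
      iteratedDeriv 2 (u 2) x * bracket (u 0) (u 1) x := by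
  simp only [wronskian, bracket, Matrix.det_fin_three, Matrix.of_apply, Fin.isValue,
    Fin.val_zero, Fin.val_one, Fin.val_two, iteratedDeriv_zero, iteratedDeriv_one]
  ring

theorem wronskian_eq_wronskian (hu : ∀ j, IsSolution γ (u j)) (x y : ℝ) :
    wronskian u x = wronskian u y := by
  have hd (t : ℝ) : HasDerivAt (wronskian u) 0 t := by
    rw [funext (wronskian_eq_bracket u)]
    refine ((((hu 0).hasDerivAt_iteratedDeriv_two t).mul ((hu 1).hasDerivAt_bracket (hu 2) t)).add
      (((hu 1).hasDerivAt_iteratedDeriv_two t).mul ((hu 2).hasDerivAt_bracket (hu 0) t))).add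
      (((hu 2).hasDerivAt_iteratedDeriv_two t).mul ((hu 0).hasDerivAt_bracket (hu 1) t))
      |>.congr_deriv ?_
    simp only [bracket]
    ring
  exact is_const_of_deriv_eq_zero (fun t => (hd t).differentiableAt) (fun t => (hd t).deriv) x y

lemma wronskian_mul_eq_sum (u : Fin 3 → ℝ → ℂ) (v : ℝ → ℂ) (x : ℝ) :
    wronskian u x * v x = ∑ j, wronskian (Function.update u j v) x * u j x := by
  set A : Matrix (Fin 3) (Fin 3) ℂ := Matrix.of fun i j => iteratedDeriv i (u j) x
  have hcramer := congrFun (A.mulVec_cramer fun i => iteratedDeriv i v x) 0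
  have hupdate (j : Fin 3) : wronskian (Function.update u j v) x =
      A.cramer (fun i => iteratedDeriv i v x) j := by
    rw [Matrix.cramer_apply, wronskian]
    congr 1
    ext i k
    rcases eq_or_ne k j with rfl | hk <;> simp [A, *]
  simp only [hupdate]
  simpa [Matrix.mulVec, dotProduct, mul_comm, A, wronskian, eq_comm] using hcramer

lemma wronskian_update_eq_zero {v : ℝ → ℂ} {x : ℝ} (hv : ∀ k < 3, iteratedDeriv k v x = 0)
    (j : Fin 3) : wronskian (Function.update u j v) x = 0 :=
  Matrix.det_eq_zero_of_column_eq_zero j fun i => by simpa using hv i i.isLt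

lemma IsSolution.wronskian_mul_eq_sum (hu : ∀ j, IsSolution γ (u j)) {v : ℝ → ℂ}
    (hv : IsSolution γ v) (x₀ x : ℝ) :
    wronskian u x₀ * v x = ∑ j, wronskian (Function.update u j v) x₀ * u j x := by
  rw [wronskian_eq_wronskian hu x₀ x, GenAiry.wronskian_mul_eq_sum]
  refine Finset.sum_congr rfl fun j _ => ?_
  rw [wronskian_eq_wronskian ((Function.forall_update_iff u fun _ => IsSolution γ).2
    ⟨hv, fun k _ => hu k⟩) x x₀]

theorem IsSolution.ext {x₀ : ℝ} (hu : ∀ j, IsSolution γ (u j)) (hW : wronskian u x₀ ≠ 0)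
    {v w : ℝ → ℂ} (hv : IsSolution γ v) (hw : IsSolution γ w)
    (h₀ : ∀ k < 3, iteratedDeriv k v x₀ = iteratedDeriv k w x₀) : v = w := by
  have hvw : IsSolution γ (v - w) := (solutionSpace γ).sub_mem hv hw
  have hjet (k : ℕ) (hk : k < 3) : iteratedDeriv k (v - w) x₀ = 0 := by
    rw [iteratedDeriv_sub (hv.1.contDiffAt.of_le (by exact_mod_cast hk.le))
      (hw.1.contDiffAt.of_le (by exact_mod_cast hk.le)), h₀ k hk, sub_self]
  refine sub_eq_zero.1 (funext fun x => (mul_eq_zero.1 ?_).resolve_left hW)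
  rw [hvw.wronskian_mul_eq_sum hu]
  exact Finset.sum_eq_zero fun j _ => by rw [wronskian_update_eq_zero hjet, zero_mul]

lemma iteratedDeriv_sum_smul (hu : ∀ j, IsSolution γ (u j)) (c : Fin 3 → ℂ) (i : Fin 3) (x : ℝ) :
    iteratedDeriv i (∑ j, c j • u j) x = ∑ j, iteratedDeriv i (u j) x * c j := by
  have h (j : Fin 3) : ContDiffAt ℝ i (c j • u j) x :=
    (((hu j).1.const_smul (c j)).of_le (by exact_mod_cast i.isLt.le)).contDiffAt
  rw [iteratedDeriv_sum fun j _ => h j]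
  exact Finset.sum_congr rfl fun j _ => by
    rw [iteratedDeriv_const_smul_field, smul_eq_mul, mul_comm]

theorem wronskian_sum_smul (hu : ∀ j, IsSolution γ (u j)) (C : Matrix (Fin 3) (Fin 3) ℂ) (x : ℝ) :
    wronskian (fun j => ∑ k, C k j • u k) x = wronskian u x * C.det := by
  rw [wronskian, wronskian, ← Matrix.det_mul]
  congr 1
  ext i j
  exact iteratedDeriv_sum_smul hu (fun k => C k j) i x

theorem isFundamentalSystem_of_wronskian_ne_zero {x₀ : ℝ} (hu : ∀ j, IsSolution γ (u j))
    (hW : wronskian u x₀ ≠ 0) : IsFundamentalSystem γ u := by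
  refine ⟨Fintype.linearIndependent_iff.2 fun c hc => ?_, fun v => ⟨fun hv => ?_, fun hv => ?_⟩⟩
  · refine congrFun (Matrix.eq_zero_of_mulVec_eq_zero hW (funext fun i => ?_))
    refine (iteratedDeriv_sum_smul hu c i x₀).symm.trans ?_
    simp [hc]
  · have h : v = ∑ j, (wronskian u x₀)⁻¹ • wronskian (Function.update u j v) x₀ • u j := by
      funext x
      rw [← Finset.smul_sum, Pi.smul_apply, smul_eq_mul, eq_inv_mul_iff_mul_eq₀ hW,
        hv.wronskian_mul_eq_sum hu, Finset.sum_apply]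
      rfl
    rw [h]
    exact Submodule.sum_mem _ fun j _ => Submodule.smul_mem _ _ <| Submodule.smul_mem _ _ <|
      Submodule.subset_span (mem_range_self j)
  · exact (Submodule.span_le (p := solutionSpace γ)).2 (range_subset_iff.2 hu) hv

end Wronskian

/-! ### Ray integrals -/

/-- The function `x ↦ ∫₀^∞ σ ^ γ exp (-σ³/3 + ζ x σ) dσ`; for `ζ ^ 3 = 1` this is, up to a constant
factor, the contour integral over the ray through `ζ`. -/
noncomputable def ray (γ ζ : ℂ) (x : ℝ) : ℂ := cubicLaplace γ 1 (ζ * x)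

/-- The three ray integrals, for the cube roots of unity `1, ω, ω ^ 2`. -/
noncomputable def rays (γ : ℂ) (j : Fin 3) : ℝ → ℂ := ray γ (ω ^ (j : ℕ))

section Ray

variable {γ ζ ξ : ℂ}

lemma hasDerivAt_ray (hγ : -1 < γ.re) (ζ : ℂ) (x : ℝ) :
    HasDerivAt (ray γ ζ) (ζ * ray (γ + 1) ζ x) x := by
  have h := hasDerivAt_cubicLaplace_comp (a := fun _ => 1) (y := fun w => ζ * w) (w := x) hγ
    (differentiable_const 1) (by fun_prop) one_pos
  refine h.comp_ofReal.congr_deriv ?_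
  simp [ray]

lemma iteratedDeriv_ray (hγ : -1 < γ.re) (ζ : ℂ) (k : ℕ) :
    iteratedDeriv k (ray γ ζ) = ζ ^ k • ray (γ + k) ζ := by
  induction k with
  | zero => simp
  | succ k ih =>
    funext x
    have h := (hasDerivAt_ray (neg_one_lt_re_add hγ (z := k) (by simp)) ζ x).const_smul (ζ ^ k)
    rw [iteratedDeriv_succ, ih, h.deriv, smul_eq_mul, Pi.smul_apply, smul_eq_mul, Nat.cast_succ,
      add_assoc, pow_succ, mul_assoc]

lemma contDiff_ray (hγ : -1 < γ.re) (ζ : ℂ) {n : ℕ∞} : ContDiff ℝ n (ray γ ζ) :=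
  contDiff_of_differentiable_iteratedDeriv fun k _ => by
    rw [iteratedDeriv_ray hγ]
    exact fun x => ((hasDerivAt_ray (neg_one_lt_re_add hγ (z := k) (by simp)) ζ
      x).differentiableAt.const_smul _)

lemma iteratedDeriv_ray_zero (hγ : -1 < γ.re) (ζ : ℂ) (k : ℕ) :
    iteratedDeriv k (ray γ ζ) 0 = ζ ^ k * cubicMoment (γ + k) := by
  rw [iteratedDeriv_ray hγ, Pi.smul_apply, smul_eq_mul, ray, Complex.ofReal_zero, mul_zero,
    cubicMoment]

theorem isSolution_ray (hγ : -1 < γ.re) (hζ : ζ ^ 3 = 1) : IsSolution γ (ray γ ζ) := by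
  have hγ₁ : -1 < (γ + 1).re := neg_one_lt_re_add hγ (by simp)
  have hγ₂ : -1 < (γ + 1 + 1).re := neg_one_lt_re_add hγ₁ (by simp)
  refine isSolution_of_hasDerivAt (hasDerivAt_ray hγ ζ)
    (fun x => (hasDerivAt_ray hγ₁ ζ x).const_mul ζ)
    (fun x => (((hasDerivAt_ray hγ₂ ζ x).const_mul ζ).const_mul ζ).congr_deriv ?_)
  have h := cubicLaplace_add_three hγ (a := 1) one_pos (ζ * x)
  rw [show γ + 3 = γ + 1 + 1 + 1 by ring] at h
  simp only [ray]
  linear_combination cubicLaplace (γ + 1 + 1 + 1) 1 (ζ * x) * hζ + h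

lemma isSolution_rays (hγ : -1 < γ.re) (j : Fin 3) : IsSolution γ (rays γ j) :=
  isSolution_ray hγ (by rw [← pow_mul, mul_comm, pow_mul, ω_pow_three, one_pow])

lemma wronskian_rays (hγ : -1 < γ.re) (x : ℝ) :
    wronskian (rays γ) x = -(2 * Real.pi * Complex.I * Complex.Gamma (γ + 1)) := by
  rw [wronskian_eq_wronskian (isSolution_rays hγ) x 0, wronskian, Matrix.det_fin_three,
    ← cubicMoment_prod hγ]
  simp only [rays, Matrix.of_apply, iteratedDeriv_ray_zero hγ]
  simp only [Fin.isValue, Fin.val_zero, Fin.val_one, Fin.val_two, Nat.cast_zero, Nat.cast_one,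
    Nat.cast_ofNat, add_zero]
  linear_combination (cubicMoment γ * cubicMoment (γ + 1) * cubicMoment (γ + 2)) *
    (ω ^ 2 - 2 * ω) * ω_pow_three

lemma wronskian_rays_ne_zero (hγ : -1 < γ.re) (x : ℝ) : wronskian (rays γ) x ≠ 0 := by
  have hΓ : Complex.Gamma (γ + 1) ≠ 0 := Complex.Gamma_ne_zero_of_re_pos (by
    rw [Complex.add_re, Complex.one_re]; linarith)
  rw [wronskian_rays hγ]
  exact neg_ne_zero.2 (mul_ne_zero Complex.two_pi_I_ne_zero hΓ)

lemma iteratedDeriv_ray_add_ray_zero (hγ : -1 < γ.re) (a b ζ ξ : ℂ) (k : ℕ) :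
    iteratedDeriv k (a • ray γ ζ + b • ray γ ξ) 0 =
      (a * ζ ^ k + b * ξ ^ k) * cubicMoment (γ + k) := by
  have hc (c η : ℂ) : ContDiffAt ℝ k (c • ray γ η) 0 :=
    ((contDiff_ray hγ η).const_smul c).contDiffAt
  rw [iteratedDeriv_add (hc a ζ) (hc b ξ), iteratedDeriv_const_smul_field,
    iteratedDeriv_const_smul_field, iteratedDeriv_ray_zero hγ, iteratedDeriv_ray_zero hγ,
    smul_eq_mul, smul_eq_mul]
  ring

lemma bracket_ray_zero (hγ : -1 < γ.re) (ζ ξ : ℂ) :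
    bracket (ray γ ζ) (ray γ ξ) 0 = (ξ - ζ) * (cubicMoment γ * cubicMoment (γ + 1)) := by
  have h₀ (η : ℂ) := iteratedDeriv_ray_zero hγ η 0
  have h₁ (η : ℂ) := iteratedDeriv_ray_zero hγ η 1
  simp only [iteratedDeriv_zero, iteratedDeriv_one, Nat.cast_zero, Nat.cast_one, add_zero] at h₀ h₁
  rw [bracket, h₀, h₀, h₁, h₁]
  ring

lemma deriv_bracket_ray_zero (hγ : -1 < γ.re) (hζ : ζ ^ 3 = 1) (hξ : ξ ^ 3 = 1) :
    deriv (bracket (ray γ ζ) (ray γ ξ)) 0 =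
      (ξ ^ 2 - ζ ^ 2) * (cubicMoment γ * cubicMoment (γ + 2)) := by
  have h₀ (η : ℂ) := iteratedDeriv_ray_zero hγ η 0
  simp only [iteratedDeriv_zero, Nat.cast_zero, add_zero] at h₀
  rw [((isSolution_ray hγ hζ).hasDerivAt_bracket (isSolution_ray hγ hξ) 0).deriv, h₀, h₀,
    iteratedDeriv_ray_zero hγ, iteratedDeriv_ray_zero hγ, Nat.cast_ofNat]
  ring

lemma iteratedDeriv_two_bracket_ray_zero (hγ : -1 < γ.re) (hζ : ζ ^ 3 = 1) (hξ : ξ ^ 3 = 1) :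
    iteratedDeriv 2 (bracket (ray γ ζ) (ray γ ξ)) 0 =
      ζ * ξ * (ξ - ζ) * (cubicMoment (γ + 1) * cubicMoment (γ + 2)) := by
  have h₁ (η : ℂ) := iteratedDeriv_ray_zero hγ η 1
  have hdd {η : ℂ} (hη : η ^ 3 = 1) := ((isSolution_ray hγ hη).hasDerivAt_deriv 0).deriv
  simp only [iteratedDeriv_one, Nat.cast_one] at h₁
  rw [iteratedDeriv_succ, iteratedDeriv_one,
    ((isSolution_ray hγ hζ).hasDerivAt_deriv_bracket (isSolution_ray hγ hξ) 0).deriv, bracket,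
    Complex.ofReal_zero, zero_mul, add_zero, hdd hζ, hdd hξ, h₁, h₁, iteratedDeriv_ray_zero hγ,
    iteratedDeriv_ray_zero hγ, Nat.cast_ofNat]
  ring

end Ray

/-- The factor by which `σ ^ γ` changes when `σ` is turned by the angle `π / 3`. -/
noncomputable def turn (γ : ℂ) : ℂ := Complex.exp (Real.pi * γ / 3 * Complex.I)

lemma turn_ne_zero (γ : ℂ) : turn γ ≠ 0 := Complex.exp_ne_zero _

lemma turn_add_one (γ : ℂ) : turn (γ + 1) = -ω ^ 2 * turn γ := by
  rw [turn, turn, ← exp_pi_div_three_mul_I, ← Complex.exp_add]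
  ring_nf

lemma turn_add_two (γ : ℂ) : turn (γ + 2) = ω * turn γ := by
  rw [show γ + 2 = γ + 1 + 1 by ring, turn_add_one, turn_add_one]
  linear_combination ω * turn γ * ω_pow_three

lemma turn_add_three (γ : ℂ) : turn (γ + 3) = -turn γ := by
  rw [show γ + 3 = γ + 1 + 2 by ring, turn_add_two, turn_add_one]
  linear_combination -turn γ * ω_pow_three

lemma cubicMoment_prod_eq_reflection {γ β : ℂ} (hγ : -1 < γ.re) (h₁ : -1 < β.re) (h₂ : β.re < 2) :
    (ω - ω ^ 2) * (cubicMoment γ * cubicMoment (γ + 1) * cubicMoment (γ + 2)) =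
      Complex.Gamma (γ + 1) * (cubicMoment β * cubicMoment (1 - β)) *
        (turn (β + 1) - (turn (β + 1))⁻¹) := by
  have hrefl := cubicMoment_mul_cubicMoment_one_sub h₁ h₂
  rw [← mul_div_assoc, Complex.exp_neg, ← turn] at hrefl
  linear_combination cubicMoment_prod hγ / 3 - Complex.Gamma (γ + 1) / 3 * hrefl

lemma cubicMoment_mul_cubicMoment_add_one {γ : ℂ} (hγ : -1 < γ.re) (hγ' : γ.re < 0) :
    (ω ^ 2 - ω) * (cubicMoment γ * cubicMoment (γ + 1)) =
      Complex.Gamma (γ + 1) * (turn γ - (turn γ)⁻¹) * cubicMoment (-1 - γ) := by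
  have hre : (γ + 2).re = γ.re + 2 := by simp
  have h := cubicMoment_prod_eq_reflection hγ (β := γ + 2) (by linarith) (by linarith)
  rw [show 1 - (γ + 2) = -1 - γ by ring, show γ + 2 + 1 = γ + 3 by ring, turn_add_three,
    inv_neg] at h
  refine mul_left_cancel₀ (cubicMoment_ne_zero (γ := γ + 2) (by linarith)) ?_
  linear_combination -h

lemma cubicMoment_mul_cubicMoment_add_two {γ : ℂ} (hγ : -1 < γ.re) (hγ' : γ.re < 1) :
    (ω - ω ^ 2) * (cubicMoment γ * cubicMoment (γ + 2)) =
      Complex.Gamma (γ + 1) * (turn γ * ω - (turn γ)⁻¹ * ω ^ 2) * cubicMoment (-1 - γ + 1) := by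
  have hre : (γ + 1).re = γ.re + 1 := by simp
  have h := cubicMoment_prod_eq_reflection hγ (β := γ + 1) (by linarith) (by linarith)
  rw [show 1 - (γ + 1) = -1 - γ + 1 by ring, show γ + 1 + 1 = γ + 2 by ring, turn_add_two,
    mul_inv, inv_ω] at h
  refine mul_left_cancel₀ (cubicMoment_ne_zero (γ := γ + 1) (by linarith)) ?_
  linear_combination h

lemma cubicMoment_add_one_mul_cubicMoment_add_two {γ : ℂ} (hγ : -1 < γ.re) (hγ' : γ.re < 2) :
    (ω ^ 2 - ω) * (cubicMoment (γ + 1) * cubicMoment (γ + 2)) =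
      Complex.Gamma (γ + 1) * (turn γ * ω ^ 2 - (turn γ)⁻¹ * ω) * cubicMoment (-1 - γ + 2) := by
  have h := cubicMoment_prod_eq_reflection hγ hγ hγ'
  rw [show 1 - γ = -1 - γ + 2 by ring, turn_add_one, mul_inv, inv_neg, inv_ω_sq] at h
  refine mul_left_cancel₀ (cubicMoment_ne_zero hγ) ?_
  linear_combination -h

section BracketRay

variable {γ ζ : ℂ}

-- Both sides solve the equation with parameter `-1 - γ`, so it is enough to compare their jets
-- of order two at `0`, where the reflection formula for the moments applies.
theorem bracket_ray (hγ : -1 < γ.re) (hγ' : γ.re < 0) (hζ : ζ ^ 3 = 1) :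
    bracket (ray γ (ζ * ω)) (ray γ (ζ * ω ^ 2)) =
      (ζ * Complex.Gamma (γ + 1) * turn γ) • ray (-1 - γ) (ζ * ω) +
        (-(ζ * Complex.Gamma (γ + 1) * (turn γ)⁻¹)) • ray (-1 - γ) (ζ * ω ^ 2) := by
  have hδ : -1 < (-1 - γ).re := by simpa
  have hζ₁ : (ζ * ω) ^ 3 = 1 := by rw [mul_pow, hζ, ω_pow_three, one_mul]
  have hζ₂ : (ζ * ω ^ 2) ^ 3 = 1 := by
    rw [mul_pow, hζ, ← pow_mul, mul_comm 2, pow_mul, ω_pow_three, one_pow, one_mul]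
  have hu := isSolution_ray hγ hζ₁
  have hv := isSolution_ray hγ hζ₂
  refine IsSolution.ext (isSolution_rays hδ) (wronskian_rays_ne_zero hδ 0) (hu.bracket hv)
    ((solutionSpace _).add_mem ((solutionSpace _).smul_mem _ (isSolution_ray hδ hζ₁))
      ((solutionSpace _).smul_mem _ (isSolution_ray hδ hζ₂))) fun k hk => ?_
  rw [iteratedDeriv_ray_add_ray_zero hδ]
  interval_cases k
  · rw [iteratedDeriv_zero, bracket_ray_zero hγ, Nat.cast_zero, add_zero]
    linear_combination ζ * cubicMoment_mul_cubicMoment_add_one hγ hγ'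
  · rw [iteratedDeriv_one, deriv_bracket_ray_zero hγ hζ₁ hζ₂, Nat.cast_one]
    linear_combination ζ ^ 2 * cubicMoment_mul_cubicMoment_add_two hγ (hγ'.trans zero_lt_one) +
      ζ ^ 2 * ω * (cubicMoment γ * cubicMoment (γ + 2)) * ω_pow_three
  · rw [iteratedDeriv_two_bracket_ray_zero hγ hζ₁ hζ₂, Nat.cast_ofNat]
    linear_combination ζ ^ 3 * cubicMoment_add_one_mul_cubicMoment_add_two hγ (hγ'.trans two_pos) +
      ζ ^ 3 * ((ω ^ 2 - ω) * (cubicMoment (γ + 1) * cubicMoment (γ + 2)) +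
        ω * Complex.Gamma (γ + 1) * (turn γ)⁻¹ * cubicMoment (-1 - γ + 2)) * ω_pow_three

theorem bracket_rays (hγ : -1 < γ.re) (hγ' : γ.re < 0) (j : Fin 3) (x : ℝ) :
    bracket (rays γ (j + 1)) (rays γ (j + 2)) x =
      ω ^ (j : ℕ) * Complex.Gamma (γ + 1) *
        (turn γ * rays (-1 - γ) (j + 1) x - (turn γ)⁻¹ * rays (-1 - γ) (j + 2) x) := by
  have hj : (ω ^ (j : ℕ)) ^ 3 = 1 := by
    rw [← pow_mul, mul_comm, pow_mul, ω_pow_three, one_pow]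
  have h := congrFun (bracket_ray hγ hγ' hj) x
  have h₁ : ω ^ ((j + 1 : Fin 3) : ℕ) = ω ^ (j : ℕ) * ω := by
    rw [ω_pow_val_add, Fin.val_one, pow_one]
  have h₂ : ω ^ ((j + 2 : Fin 3) : ℕ) = ω ^ (j : ℕ) * ω ^ 2 := ω_pow_val_add j 2
  rw [rays, rays, rays, rays, h₁, h₂, h, Pi.add_apply, Pi.smul_apply, Pi.smul_apply, smul_eq_mul,
    smul_eq_mul]
  ring

end BracketRay

lemma turn_neg_one_sub (γ : ℂ) : turn (-1 - γ) = -ω * (turn γ)⁻¹ := by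
  have h : turn (-1 - γ) * turn (γ + 1) = 1 := by
    rw [turn, turn, ← Complex.exp_add, ← Complex.exp_zero]
    ring_nf
  rw [turn_add_one] at h
  field_simp [turn_ne_zero γ]
  linear_combination -ω * h - turn γ * turn (-1 - γ) * ω_pow_three

lemma bracket_sum_smul {u : Fin 3 → ℝ → ℂ} (hu : ∀ j, Differentiable ℝ (u j)) (c d : Fin 3 → ℂ)
    (x : ℝ) : bracket (∑ j, c j • u j) (∑ j, d j • u j) x =
      crossProduct c d ⬝ᵥ
        ![bracket (u 1) (u 2) x, bracket (u 2) (u 0) x, bracket (u 0) (u 1) x] := by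
  have hd (e : Fin 3 → ℂ) : deriv (∑ j, e j • u j) x = ∑ j, e j * deriv (u j) x := by
    rw [deriv_sum fun j _ => ((hu j).const_smul (e j)) x]
    simp only [deriv_const_smul_field, smul_eq_mul]
  simp only [bracket, hd]
  simp only [cross_apply, Finset.sum_apply, Pi.smul_apply, smul_eq_mul,
    Fin.sum_univ_three, Matrix.vec3_dotProduct, Matrix.cons_val]
  ring

/-! ### Airy functions as combinations of ray integrals -/

section HasOscIntegral

variable {f g : ℝ → ℂ} {a b : ℂ}

lemma HasOscIntegral.add (hf : HasOscIntegral f a) (hg : HasOscIntegral g b) :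
    HasOscIntegral (fun σ => f σ + g σ) (a + b) := by
  simp only [HasOscIntegral, mul_add]
  refine ⟨fun ε hε => (hf.1 ε hε).add (hg.1 ε hε), (hf.2.add hg.2).congr' ?_⟩
  filter_upwards [self_mem_nhdsWithin] with ε hε
  exact (integral_add (hf.1 ε hε) (hg.1 ε hε)).symm

lemma HasOscIntegral.const_mul (hf : HasOscIntegral f a) (c : ℂ) :
    HasOscIntegral (fun σ => c * f σ) (c * a) := by
  simp only [HasOscIntegral, mul_left_comm _ c]
  exact ⟨fun ε hε => (hf.1 ε hε).const_mul c,
    (hf.2.const_mul c).congr fun ε => (integral_const_mul _ _).symm⟩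

lemma HasOscIntegral.oscIntegral_eq (hf : HasOscIntegral f a) : oscIntegral f = a :=
  hf.2.limUnder_eq

end HasOscIntegral

lemma exp_neg_mul_kernel (γ a y : ℂ) (ε σ : ℝ) :
    (Real.exp (-ε * σ) : ℂ) * kernel γ a y σ = kernel γ a (y - ε) σ := by
  rw [kernel, kernel, Complex.ofReal_exp, mul_left_comm, ← Complex.exp_add]
  congr 2
  push_cast
  ring

theorem hasOscIntegral_kernel_exp {γ y w : ℂ} (hγ : -1 < γ.re) (hy : y.re ≤ 0)
    (hw : |w.im| ≤ Real.pi / 6) :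
    HasOscIntegral (kernel γ (Complex.exp (-3 * w)) y)
      (Complex.exp ((γ + 1) * w) * cubicLaplace γ 1 (Complex.exp w * y)) := by
  have hre {ε : ℝ} (hε : 0 < ε) : (y - ε).re < 0 := by
    rw [Complex.sub_re, Complex.ofReal_re]
    linarith
  simp only [HasOscIntegral, exp_neg_mul_kernel]
  refine ⟨fun ε hε =>
    integrableOn_kernel_of_re_neg hγ (exp_neg_three_mul_re_nonneg hw) (hre hε), ?_⟩
  have hcont : Continuous fun ε : ℝ =>
      Complex.exp ((γ + 1) * w) * cubicLaplace γ 1 (Complex.exp w * (y - ε)) :=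
    continuous_const.mul ((differentiable_cubicLaplace_one hγ).continuous.comp (by fun_prop))
  refine ((hcont.tendsto' 0 _ (by simp)).mono_left nhdsWithin_le_nhds).congr' ?_
  filter_upwards [self_mem_nhdsWithin] with ε hε
  exact (cubicLaplace_exp_of_abs_im_le hγ (hre hε) hw).symm

/-- The integrand `σ ^ γ exp (s (σ³/3 + x σ - γ π / 2))`; the integrands of `Ai_γ` and `Gi_γ` are
combinations of the cases `s = ± i`. -/
noncomputable def expIntegrand (γ s : ℂ) (x σ : ℝ) : ℂ :=
  (σ : ℂ) ^ γ * Complex.exp (s * phase γ x σ)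

lemma expIntegrand_eq_kernel (γ s : ℂ) (x : ℝ) : expIntegrand γ s x = fun σ =>
    Complex.exp (-(s * (γ * Real.pi / 2))) * kernel γ (-s) (s * x) σ := by
  ext σ
  rw [expIntegrand, kernel, phase, mul_left_comm, ← Complex.exp_add]
  congr 2
  ring

lemma aiIntegrand_eq_expIntegrand (γ : ℂ) (x : ℝ) : aiIntegrand γ x = fun σ =>
    2⁻¹ * expIntegrand γ Complex.I x σ + 2⁻¹ * expIntegrand γ (-Complex.I) x σ := by
  ext σ
  rw [aiIntegrand, Complex.cos, expIntegrand, expIntegrand, mul_comm Complex.I, neg_mul_comm,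
    mul_comm (-Complex.I)]
  ring

lemma giIntegrand_eq_expIntegrand (γ : ℂ) (x : ℝ) : giIntegrand γ x = fun σ =>
    -(Complex.I / 2) * expIntegrand γ Complex.I x σ +
      Complex.I / 2 * expIntegrand γ (-Complex.I) x σ := by
  ext σ
  rw [giIntegrand, Complex.sin, expIntegrand, expIntegrand, mul_comm Complex.I, neg_mul_comm,
    mul_comm (-Complex.I)]
  ring

lemma hiIntegrand_eq_kernel (γ : ℂ) (x : ℝ) : hiIntegrand γ x = kernel γ 1 x := by
  ext σ
  rw [hiIntegrand, kernel]
  congr 2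
  ring

lemma exp_pi_div_six_mul_I : Complex.exp (Real.pi / 6 * Complex.I) = -Complex.I * ω := by
  rw [← Complex.exp_neg_pi_div_two_mul_I, ω, ← Complex.exp_add]
  ring_nf

lemma exp_neg_pi_div_six_mul_I : Complex.exp (-(Real.pi / 6 * Complex.I)) = Complex.I * ω ^ 2 := by
  rw [Complex.exp_neg, exp_pi_div_six_mul_I, mul_inv, inv_neg, Complex.inv_I, neg_neg, inv_ω]

lemma hasOscIntegral_expIntegrand_I {γ : ℂ} (hγ : -1 < γ.re) (x : ℝ) :
    HasOscIntegral (expIntegrand γ Complex.I x) (-Complex.I * ω * (turn γ)⁻¹ * rays γ 1 x) := by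
  have ha : Complex.exp (-3 * (Real.pi / 6 * Complex.I)) = -Complex.I := by
    rw [← Complex.exp_neg_pi_div_two_mul_I]
    ring_nf
  have hc : Complex.exp (-(Complex.I * (γ * Real.pi / 2))) *
      Complex.exp ((γ + 1) * (Real.pi / 6 * Complex.I)) = -Complex.I * ω * (turn γ)⁻¹ := by
    rw [← exp_pi_div_six_mul_I, turn, ← Complex.exp_neg, ← Complex.exp_add, ← Complex.exp_add]
    ring_nf
  have h := (hasOscIntegral_kernel_exp (y := Complex.I * x) (w := Real.pi / 6 * Complex.I) hγ
    (by simp) (by simp [abs_div, abs_of_pos Real.pi_pos])).const_mul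
      (Complex.exp (-(Complex.I * (γ * Real.pi / 2))))
  rw [ha, ← mul_assoc, hc, exp_pi_div_six_mul_I, ← expIntegrand_eq_kernel] at h
  convert h using 2
  rw [rays, ray, Fin.val_one, pow_one]
  congr 1
  linear_combination ω * x * Complex.I_sq

lemma hasOscIntegral_expIntegrand_neg_I {γ : ℂ} (hγ : -1 < γ.re) (x : ℝ) :
    HasOscIntegral (expIntegrand γ (-Complex.I) x)
      (Complex.I * ω ^ 2 * turn γ * rays γ 2 x) := by
  have ha : Complex.exp (-3 * -(Real.pi / 6 * Complex.I)) = - -Complex.I := by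
    rw [neg_neg, mul_neg, neg_mul, neg_neg]
    refine Eq.trans ?_ Complex.exp_pi_div_two_mul_I
    ring_nf
  have hc : Complex.exp (-(-Complex.I * (γ * Real.pi / 2))) *
      Complex.exp ((γ + 1) * -(Real.pi / 6 * Complex.I)) = Complex.I * ω ^ 2 * turn γ := by
    rw [← exp_neg_pi_div_six_mul_I, turn, ← Complex.exp_add, ← Complex.exp_add]
    ring_nf
  have h := (hasOscIntegral_kernel_exp (y := -Complex.I * x) (w := -(Real.pi / 6 * Complex.I)) hγ
    (by simp) (by simp [abs_div, abs_of_pos Real.pi_pos])).const_mul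
      (Complex.exp (-(-Complex.I * (γ * Real.pi / 2))))
  rw [ha, ← mul_assoc, hc, exp_neg_pi_div_six_mul_I, ← expIntegrand_eq_kernel] at h
  convert h using 2
  rw [rays, ray, Fin.val_two]
  congr 1
  linear_combination ω ^ 2 * x * Complex.I_sq

theorem hasOscIntegral_aiIntegrand {γ : ℂ} (hγ : -1 < γ.re) (x : ℝ) :
    HasOscIntegral (aiIntegrand γ x)
      (2⁻¹ * (-Complex.I * ω * (turn γ)⁻¹ * rays γ 1 x) +
        2⁻¹ * (Complex.I * ω ^ 2 * turn γ * rays γ 2 x)) := by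
  rw [aiIntegrand_eq_expIntegrand]
  exact ((hasOscIntegral_expIntegrand_I hγ x).const_mul _).add
    ((hasOscIntegral_expIntegrand_neg_I hγ x).const_mul _)

theorem hasOscIntegral_giIntegrand {γ : ℂ} (hγ : -1 < γ.re) (x : ℝ) :
    HasOscIntegral (giIntegrand γ x)
      (-(Complex.I / 2) * (-Complex.I * ω * (turn γ)⁻¹ * rays γ 1 x) +
        Complex.I / 2 * (Complex.I * ω ^ 2 * turn γ * rays γ 2 x)) := by
  rw [giIntegrand_eq_expIntegrand]
  exact ((hasOscIntegral_expIntegrand_I hγ x).const_mul _).add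
    ((hasOscIntegral_expIntegrand_neg_I hγ x).const_mul _)

lemma hasOscIntegral_Ai {γ : ℂ} (hγ : -1 < γ.re) (x : ℝ) :
    HasOscIntegral (aiIntegrand γ x) (Real.pi * Ai γ x) := by
  have h := hasOscIntegral_aiIntegrand hγ x
  rwa [Ai, h.oscIntegral_eq, one_div,
    mul_inv_cancel_left₀ (Complex.ofReal_ne_zero.2 Real.pi_ne_zero)]

lemma hasOscIntegral_Gi {γ : ℂ} (hγ : -1 < γ.re) (x : ℝ) :
    HasOscIntegral (giIntegrand γ x) (Real.pi * Gi γ x) := by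
  have h := hasOscIntegral_giIntegrand hγ x
  rwa [Gi, h.oscIntegral_eq, one_div,
    mul_inv_cancel_left₀ (Complex.ofReal_ne_zero.2 Real.pi_ne_zero)]

lemma Ai_apply {γ : ℂ} (hγ : -1 < γ.re) (x : ℝ) : Ai γ x = Complex.I / (2 * Real.pi) *
    (ω ^ 2 * turn γ * rays γ 2 x - ω * (turn γ)⁻¹ * rays γ 1 x) := by
  rw [Ai, (hasOscIntegral_aiIntegrand hγ x).oscIntegral_eq]
  ring

lemma Gi_apply {γ : ℂ} (hγ : -1 < γ.re) (x : ℝ) : Gi γ x = -(2 * Real.pi : ℂ)⁻¹ *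
    (ω * (turn γ)⁻¹ * rays γ 1 x + ω ^ 2 * turn γ * rays γ 2 x) := by
  rw [Gi, (hasOscIntegral_giIntegrand hγ x).oscIntegral_eq]
  linear_combination (2 * Real.pi : ℂ)⁻¹ *
    (ω * (turn γ)⁻¹ * rays γ 1 x + ω ^ 2 * turn γ * rays γ 2 x) * Complex.I_sq

lemma Hi_apply (γ : ℂ) (x : ℝ) : Hi γ x = (Real.pi : ℂ)⁻¹ * rays γ 0 x := by
  simp [Hi, hiIntegrand_eq_kernel, rays, ray, cubicLaplace]

/-- The matrix whose columns are the coordinates of `Ai_γ`, `Gi_γ` and `Hi_γ` in terms of the ray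
integrals. -/
noncomputable def connectionMatrix (γ : ℂ) : Matrix (Fin 3) (Fin 3) ℂ :=
  (2 * Real.pi : ℂ)⁻¹ • !![0, 0, 2;
    -Complex.I * ω * (turn γ)⁻¹, -ω * (turn γ)⁻¹, 0;
    Complex.I * ω ^ 2 * turn γ, -ω ^ 2 * turn γ, 0]

theorem Ai_Gi_Hi_eq_sum_rays {γ : ℂ} (hγ : -1 < γ.re) (j : Fin 3) :
    ![Ai γ, Gi γ, Hi γ] j = ∑ k, connectionMatrix γ k j • rays γ k := by
  ext x
  fin_cases j
  · refine (Ai_apply hγ x).trans ?_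
    simp only [connectionMatrix, Fin.zero_eta, Matrix.smul_apply, Matrix.of_apply,
      Matrix.cons_val', Matrix.cons_val, Matrix.cons_val_fin_one, Finset.sum_apply, Pi.smul_apply,
      Fin.sum_univ_three, smul_eq_mul]
    ring
  · refine (Gi_apply hγ x).trans ?_
    simp only [connectionMatrix, Fin.mk_one, Matrix.smul_apply, Matrix.of_apply,
      Matrix.cons_val', Matrix.cons_val, Matrix.cons_val_fin_one, Finset.sum_apply, Pi.smul_apply,
      Fin.sum_univ_three, smul_eq_mul]
    ring
  · refine (Hi_apply γ x).trans ?_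
    simp [connectionMatrix, Fin.sum_univ_three]

lemma det_connectionMatrix (γ : ℂ) :
    (connectionMatrix γ).det = Complex.I / (2 * Real.pi ^ 3) := by
  rw [connectionMatrix, Matrix.det_smul, Matrix.det_fin_three]
  simp only [Fintype.card_fin, Matrix.of_apply, Matrix.cons_val', Matrix.cons_val,
    Matrix.cons_val_fin_one]
  field_simp [turn_ne_zero γ]
  linear_combination 4 * turn γ * Complex.I * ω_pow_three

theorem wronskian_Ai_Gi_Hi {γ : ℂ} (hγ : -1 < γ.re) (x : ℝ) :
    wronskian ![Ai γ, Gi γ, Hi γ] x = Complex.Gamma (γ + 1) / (Real.pi : ℂ) ^ 2 := by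
  rw [funext (Ai_Gi_Hi_eq_sum_rays hγ), wronskian_sum_smul (isSolution_rays hγ),
    wronskian_rays hγ, det_connectionMatrix]
  field_simp
  linear_combination -Complex.Gamma (γ + 1) * Complex.I_sq

theorem isFundamentalSystem_Ai_Gi_Hi {γ : ℂ} (hγ : -1 < γ.re) :
    IsFundamentalSystem γ ![Ai γ, Gi γ, Hi γ] := by
  refine isFundamentalSystem_of_wronskian_ne_zero (x₀ := 0) (fun j => ?_) ?_
  · rw [Ai_Gi_Hi_eq_sum_rays hγ]
    exact (solutionSpace γ).sum_mem fun k _ =>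
      (solutionSpace γ).smul_mem _ (isSolution_rays hγ k)
  · rw [wronskian_Ai_Gi_Hi hγ]
    exact div_ne_zero (Complex.Gamma_ne_zero_of_re_pos (by simpa using neg_lt_iff_pos_add.1 hγ))
      (by simp [Real.pi_ne_zero])

lemma cos_pi_mul_eq_turn (γ : ℂ) :
    Complex.cos (Real.pi * γ) = (turn γ ^ 3 + (turn γ)⁻¹ ^ 3) / 2 := by
  rw [Complex.cos, turn, ← Complex.exp_neg, ← Complex.exp_nat_mul, ← Complex.exp_nat_mul]
  ring_nf

lemma sin_pi_mul_eq_turn (γ : ℂ) :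
    Complex.sin (Real.pi * γ) = ((turn γ)⁻¹ ^ 3 - turn γ ^ 3) * Complex.I / 2 := by
  rw [Complex.sin, turn, ← Complex.exp_neg, ← Complex.exp_nat_mul, ← Complex.exp_nat_mul]
  ring_nf

section CrossProduct

variable (γ : ℂ)

lemma crossProduct_connectionMatrix_zero_one :
    crossProduct ((connectionMatrix γ).col 0) ((connectionMatrix γ).col 1) =
      (2 * Real.pi ^ 2 : ℂ)⁻¹ • ![Complex.I, 0, 0] := by
  rw [cross_apply]
  simp only [connectionMatrix, Matrix.col_apply, Matrix.smul_apply, Matrix.of_apply,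
    Matrix.cons_val', Matrix.cons_val, Matrix.cons_val_fin_one, Matrix.smul_vec3, smul_eq_mul]
  refine Matrix.vec3_eq ?_ (by ring) (by ring)
  field_simp [turn_ne_zero γ]
  linear_combination 2 * ω_pow_three

lemma crossProduct_connectionMatrix_zero_two :
    crossProduct ((connectionMatrix γ).col 0) ((connectionMatrix γ).col 2) =
      (2 * Real.pi ^ 2 : ℂ)⁻¹ • ![0, Complex.I * ω ^ 2 * turn γ, Complex.I * ω * (turn γ)⁻¹] := by
  rw [cross_apply]
  simp only [connectionMatrix, Matrix.col_apply, Matrix.smul_apply, Matrix.of_apply,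
    Matrix.cons_val', Matrix.cons_val, Matrix.cons_val_fin_one, Matrix.smul_vec3, smul_eq_mul]
  exact Matrix.vec3_eq (by ring) (by ring) (by ring)

lemma crossProduct_connectionMatrix_one_two :
    crossProduct ((connectionMatrix γ).col 1) ((connectionMatrix γ).col 2) =
      (2 * Real.pi ^ 2 : ℂ)⁻¹ • ![0, -ω ^ 2 * turn γ, ω * (turn γ)⁻¹] := by
  rw [cross_apply]
  simp only [connectionMatrix, Matrix.col_apply, Matrix.smul_apply, Matrix.of_apply,
    Matrix.cons_val', Matrix.cons_val, Matrix.cons_val_fin_one, Matrix.smul_vec3, smul_eq_mul]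
  exact Matrix.vec3_eq (by ring) (by ring) (by ring)

end CrossProduct

section Brackets

variable {γ : ℂ} (hγ : -1 < γ.re) (hγ' : γ.re < 0) (x : ℝ)

include hγ' in
lemma Ai_neg_one_sub_apply : Ai (-1 - γ) x = Complex.I / (2 * Real.pi) *
    (turn γ * rays (-1 - γ) 1 x - (turn γ)⁻¹ * rays (-1 - γ) 2 x) := by
  rw [Ai_apply (by simpa), turn_neg_one_sub, mul_inv, inv_neg, inv_inv, inv_ω]
  linear_combination Complex.I / (2 * Real.pi) *
    (turn γ * rays (-1 - γ) 1 x - (turn γ)⁻¹ * rays (-1 - γ) 2 x) * ω_pow_three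

include hγ' in
lemma Gi_neg_one_sub_apply : Gi (-1 - γ) x = (2 * Real.pi : ℂ)⁻¹ *
    (turn γ * rays (-1 - γ) 1 x + (turn γ)⁻¹ * rays (-1 - γ) 2 x) := by
  rw [Gi_apply (by simpa), turn_neg_one_sub, mul_inv (-ω), inv_neg, inv_inv, inv_ω]
  linear_combination (2 * Real.pi : ℂ)⁻¹ *
    (turn γ * rays (-1 - γ) 1 x + (turn γ)⁻¹ * rays (-1 - γ) 2 x) * ω_pow_three

include hγ hγ'

lemma bracket_Ai_Gi_Hi (i j : Fin 3) :
    bracket (![Ai γ, Gi γ, Hi γ] i) (![Ai γ, Gi γ, Hi γ] j) x = Complex.Gamma (1 + γ) *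
      (crossProduct ((connectionMatrix γ).col i) ((connectionMatrix γ).col j) ⬝ᵥ
        ![turn γ * rays (-1 - γ) 1 x - (turn γ)⁻¹ * rays (-1 - γ) 2 x,
          ω * (turn γ * rays (-1 - γ) 2 x - (turn γ)⁻¹ * rays (-1 - γ) 0 x),
          ω ^ 2 * (turn γ * rays (-1 - γ) 0 x - (turn γ)⁻¹ * rays (-1 - γ) 1 x)]) := by
  rw [Ai_Gi_Hi_eq_sum_rays hγ, Ai_Gi_Hi_eq_sum_rays hγ,
    bracket_sum_smul fun j => (isSolution_rays hγ j).1.differentiable (by norm_num),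
    ← smul_eq_mul, ← dotProduct_smul, add_comm 1 γ]
  congr 1
  ext k
  have h := bracket_rays hγ hγ' k x
  fin_cases k <;> exact h.trans (by simp [mul_assoc, mul_left_comm])

theorem bracket_Ai_Gi : bracket (Ai γ) (Gi γ) x =
    Complex.Gamma (1 + γ) / (Real.pi : ℂ) * Ai (-1 - γ) x := by
  refine (bracket_Ai_Gi_Hi hγ hγ' x 0 1).trans ?_
  rw [crossProduct_connectionMatrix_zero_one, smul_dotProduct, Matrix.vec3_dotProduct,
    Ai_neg_one_sub_apply hγ']
  simp only [smul_eq_mul, Matrix.cons_val]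
  ring

theorem bracket_Ai_Hi : bracket (Ai γ) (Hi γ) x =
    Complex.Gamma (1 + γ) / (Real.pi : ℂ) * (-Complex.cos (Real.pi * γ) * Ai (-1 - γ) x -
      Complex.sin (Real.pi * γ) * Gi (-1 - γ) x) := by
  refine (bracket_Ai_Gi_Hi hγ hγ' x 0 2).trans ?_
  rw [crossProduct_connectionMatrix_zero_two, smul_dotProduct, Matrix.vec3_dotProduct,
    Ai_neg_one_sub_apply hγ', Gi_neg_one_sub_apply hγ', cos_pi_mul_eq_turn, sin_pi_mul_eq_turn]
  simp only [smul_eq_mul, Matrix.cons_val]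
  have h := turn_ne_zero γ
  field_simp
  linear_combination 2 * Complex.Gamma (1 + γ) * turn γ ^ 2 * Complex.I *
    (turn γ ^ 4 * rays (-1 - γ) 2 x - rays (-1 - γ) 1 x) * ω_pow_three

theorem bracket_Gi_Hi : bracket (Gi γ) (Hi γ) x =
    Complex.Gamma (1 + γ) / (Real.pi : ℂ) * (Complex.sin (Real.pi * γ) * Ai (-1 - γ) x -
      Complex.cos (Real.pi * γ) * Gi (-1 - γ) x + Hi (-1 - γ) x) := by
  refine (bracket_Ai_Gi_Hi hγ hγ' x 1 2).trans ?_
  rw [crossProduct_connectionMatrix_one_two, smul_dotProduct, Matrix.vec3_dotProduct,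
    Ai_neg_one_sub_apply hγ', Gi_neg_one_sub_apply hγ', Hi_apply, cos_pi_mul_eq_turn,
    sin_pi_mul_eq_turn]
  simp only [smul_eq_mul, Matrix.cons_val]
  have h := turn_ne_zero γ
  field_simp
  linear_combination 2 * Complex.Gamma (1 + γ) * turn γ ^ 2 *
      (2 * turn γ ^ 2 * rays (-1 - γ) 0 x - turn γ ^ 4 * rays (-1 - γ) 2 x - rays (-1 - γ) 1 x) *
        ω_pow_three -
    Complex.Gamma (1 + γ) * (turn γ ^ 2 * rays (-1 - γ) 1 x - rays (-1 - γ) 2 x) *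
      (1 - turn γ ^ 6) * Complex.I_sq

end Brackets

/-! ### Improper integrals -/

section Abel

lemma exists_norm_le_of_tendsto_atTop {E : Type*} [SeminormedAddCommGroup E] {S : ℝ → E} {L : E}
    (hS : Continuous S) (hL : Tendsto S atTop (𝓝 L)) (a : ℝ) : ∃ C, ∀ R, a ≤ R → ‖S R‖ ≤ C := by
  obtain ⟨N, hN⟩ := eventually_atTop.1 (hL.norm.eventually_le_const (lt_add_one ‖L‖))
  obtain ⟨B, hB⟩ := (isCompact_Icc (a := a) (b := N)).exists_bound_of_continuousOn hS.continuousOn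
  refine ⟨max B (‖L‖ + 1), fun R hR => ?_⟩
  rcases le_total R N with h | h
  · exact (hB R ⟨hR, h⟩).trans (le_max_left _ _)
  · exact (hN R h).trans (le_max_right _ _)

variable {S f : ℝ → ℂ} {L : ℂ} {ε : ℝ}

lemma integrableOn_exp_neg_mul (hS : Continuous S) (hL : Tendsto S atTop (𝓝 L)) (hε : 0 < ε) :
    IntegrableOn (fun σ : ℝ => (Real.exp (-ε * σ) : ℂ) * S σ) (Ioi 0) := by
  obtain ⟨C, hC⟩ := exists_norm_le_of_tendsto_atTop hS hL 0
  refine Integrable.mono' ((integrableOn_exp_mul_Ioi (neg_neg_of_pos hε) 0).mul_const C)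
    (by fun_prop : Continuous fun σ : ℝ => (Real.exp (-ε * σ) : ℂ) * S σ).aestronglyMeasurable ?_
  refine ae_restrict_of_forall_mem measurableSet_Ioi fun σ hσ => ?_
  rw [norm_mul, Complex.norm_real, Real.norm_of_nonneg (Real.exp_nonneg _)]
  exact mul_le_mul_of_nonneg_left (hC σ (mem_Ioi.1 hσ).le) (Real.exp_nonneg _)

lemma integral_exp_neg_mul_eq_mul_integral (hS : Continuous S) (hL : Tendsto S atTop (𝓝 L))
    (hS₀ : S 0 = 0) (hderiv : ∀ σ ∈ Ioi 0, HasDerivAt S (f σ) σ) (hε : 0 < ε)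
    (hf : IntegrableOn (fun σ : ℝ => (Real.exp (-ε * σ) : ℂ) * f σ) (Ioi 0)) :
    ∫ σ in Ioi (0 : ℝ), (Real.exp (-ε * σ) : ℂ) * f σ =
      ε * ∫ σ in Ioi (0 : ℝ), (Real.exp (-ε * σ) : ℂ) * S σ := by
  have hprod : ∀ σ ∈ Ioi (0 : ℝ), HasDerivAt (fun σ : ℝ => (Real.exp (-ε * σ) : ℂ) * S σ)
      ((Real.exp (-ε * σ) : ℂ) * f σ - ε * ((Real.exp (-ε * σ) : ℂ) * S σ)) σ := by
    intro σ hσ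
    have hexp : HasDerivAt (fun σ : ℝ => Real.exp (-ε * σ)) (Real.exp (-ε * σ) * -ε) σ := by
      simpa using ((hasDerivAt_id σ).const_mul (-ε)).exp
    refine (hexp.ofReal_comp.mul (hderiv σ hσ)).congr_deriv ?_
    push_cast
    ring
  have htop : Tendsto (fun σ : ℝ => (Real.exp (-ε * σ) : ℂ) * S σ) atTop (𝓝 0) := by
    have hexp : Tendsto (fun σ : ℝ => Real.exp (-ε * σ)) atTop (𝓝 0) :=
      Real.tendsto_exp_atBot.comp (tendsto_id.const_mul_atTop_of_neg (neg_neg_of_pos hε))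
    simpa using hexp.ofReal.mul hL
  have hSint := (integrableOn_exp_neg_mul hS hL hε).const_mul (ε : ℂ)
  have hcont : Continuous fun σ : ℝ => (Real.exp (-ε * σ) : ℂ) * S σ := by fun_prop
  have key := integral_Ioi_of_hasDerivAt_of_tendsto hcont.continuousWithinAt hprod
    (hf.sub hSint) htop
  rw [integral_sub hf hSint, integral_const_mul, hS₀, mul_zero, sub_zero] at key
  exact sub_eq_zero.1 key

lemma tendsto_mul_integral_exp_neg_mul (hS : Continuous S) (hL : Tendsto S atTop (𝓝 L)) :
    Tendsto (fun ε : ℝ => ε * ∫ σ in Ioi (0 : ℝ), (Real.exp (-ε * σ) : ℂ) * S σ) (𝓝[>] 0)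
      (𝓝 L) := by
  obtain ⟨C, hC⟩ := exists_norm_le_of_tendsto_atTop hS hL 0
  have hlim : Tendsto (fun ε : ℝ => ∫ t in Ioi (0 : ℝ), (Real.exp (-t) : ℂ) * S (ε⁻¹ * t))
      (𝓝[>] 0) (𝓝 (∫ t in Ioi (0 : ℝ), (Real.exp (-t) : ℂ) * L)) := by
    refine tendsto_integral_filter_of_dominated_convergence (fun t : ℝ => Real.exp (-t) * C)
      (Eventually.of_forall fun ε => ?_) ?_ ((integrableOn_exp_neg_Ioi 0).mul_const C) ?_
    · exact (by fun_prop : Continuous fun t : ℝ =>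
        (Real.exp (-t) : ℂ) * S (ε⁻¹ * t)).aestronglyMeasurable
    · filter_upwards [self_mem_nhdsWithin] with ε hε
      refine ae_restrict_of_forall_mem measurableSet_Ioi fun t ht => ?_
      rw [norm_mul, Complex.norm_real, Real.norm_of_nonneg (Real.exp_nonneg _)]
      exact mul_le_mul_of_nonneg_left
        (hC _ (mul_nonneg (inv_nonneg.2 (mem_Ioi.1 hε).le) (mem_Ioi.1 ht).le)) (Real.exp_nonneg _)
    · refine ae_restrict_of_forall_mem measurableSet_Ioi fun t ht => ?_
      exact (hL.comp (tendsto_inv_nhdsGT_zero.atTop_mul_const ht)).const_mul _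
  rw [integral_mul_const, integral_complex_ofReal, integral_exp_neg_Ioi_zero, Complex.ofReal_one,
    one_mul] at hlim
  refine hlim.congr' ?_
  filter_upwards [self_mem_nhdsWithin] with ε hε
  have hsub := integral_comp_mul_left_Ioi' (fun t : ℝ => (Real.exp (-t) : ℂ) * S (ε⁻¹ * t)) 0 hε
  rw [mul_zero, Complex.real_smul] at hsub
  simp only [← hsub, inv_mul_cancel_left₀ (mem_Ioi.1 hε).ne', neg_mul]

theorem HasOscIntegral.tendsto_intervalIntegral {A : ℂ} (h : HasOscIntegral f A)
    (hcont : ContinuousOn f (Ioi 0)) (hint : ∀ a b, IntervalIntegrable f volume a b)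
    (hL : Tendsto (fun R : ℝ => ∫ σ in (0 : ℝ)..R, f σ) atTop (𝓝 L)) :
    Tendsto (fun R : ℝ => ∫ σ in (0 : ℝ)..R, f σ) atTop (𝓝 A) := by
  have hS := intervalIntegral.continuous_primitive hint 0
  have hderiv : ∀ σ ∈ Ioi (0 : ℝ), HasDerivAt (fun R => ∫ σ in (0 : ℝ)..R, f σ) (f σ) σ :=
    fun σ hσ => intervalIntegral.integral_hasDerivAt_right (hint 0 σ)
      (hcont.stronglyMeasurableAtFilter isOpen_Ioi σ hσ) (hcont.continuousAt (Ioi_mem_nhds hσ))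
  suffices hA : L = A by rwa [← hA]
  refine tendsto_nhds_unique (tendsto_mul_integral_exp_neg_mul hS hL) (h.2.congr' ?_)
  filter_upwards [self_mem_nhdsWithin] with ε hε
  exact integral_exp_neg_mul_eq_mul_integral hS hL intervalIntegral.integral_same hderiv hε
    (h.1 ε hε)

end Abel

section ImproperIntegral

variable {γ a y : ℂ}

lemma norm_kernel_of_re_eq_zero (ha : a.re = 0) (hy : y.re = 0) {σ : ℝ} (hσ : 0 < σ) :
    ‖kernel γ a y σ‖ = σ ^ γ.re := by
  rw [norm_kernel _ _ _ hσ]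
  simp [ha, hy]

lemma intervalIntegrable_kernel_of_pos (γ a y : ℂ) {c d : ℝ} (hc : 0 < c) (hd : 0 < d) :
    IntervalIntegrable (kernel γ a y) volume c d := by
  refine ((continuousOn_kernel γ a y).mono fun s hs => ?_).intervalIntegrable
  exact (lt_min hc hd).trans_le hs.1

lemma intervalIntegrable_kernel (hγ : -1 < γ.re) (a y : ℂ) (c d : ℝ) :
    IntervalIntegrable (kernel γ a y) volume c d :=
  (intervalIntegral.intervalIntegrable_cpow' hγ).mul_continuousOn (by fun_prop)

lemma exists_tendsto_integral_kernel_of_lt_neg_one (ha : a.re = 0) (hy : y.re = 0)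
    (hγ : γ.re < -1) :
    ∃ L, Tendsto (fun R : ℝ => ∫ σ in (1 : ℝ)..R, kernel γ a y σ) atTop (𝓝 L) := by
  refine ⟨_, intervalIntegral_tendsto_integral_Ioi 1 ?_ tendsto_id⟩
  refine Integrable.mono' (integrableOn_Ioi_rpow_of_lt hγ one_pos)
    (((continuousOn_kernel γ a y).mono (Ioi_subset_Ioi zero_le_one)).aestronglyMeasurable
      measurableSet_Ioi) ?_
  exact ae_restrict_of_forall_mem measurableSet_Ioi fun σ hσ =>
    (norm_kernel_of_re_eq_zero ha hy (one_pos.trans hσ)).le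

lemma tendsto_kernel_atTop (ha : a.re = 0) (hy : y.re = 0) (hγ : γ.re < 0) :
    Tendsto (kernel γ a y) atTop (𝓝 0) := by
  refine squeeze_zero_norm' ?_ (tendsto_rpow_neg_atTop (neg_pos.2 hγ))
  filter_upwards [eventually_gt_atTop 0] with σ hσ
  rw [norm_kernel_of_re_eq_zero ha hy hσ, neg_neg]

lemma integral_deriv_kernel (γ a y : ℂ) {R : ℝ} (hR : 0 < R) :
    (γ + 1) * (∫ σ in (1 : ℝ)..R, kernel γ a y σ) -
      a * (∫ σ in (1 : ℝ)..R, kernel (γ + 3) a y σ) +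
      y * (∫ σ in (1 : ℝ)..R, kernel (γ + 1) a y σ) =
        kernel (γ + 1) a y R - kernel (γ + 1) a y 1 := by
  have hint (c β : ℂ) : IntervalIntegrable (fun σ => c * kernel β a y σ) volume 1 R :=
    (intervalIntegrable_kernel_of_pos β a y one_pos hR).const_mul c
  rw [← intervalIntegral.integral_eq_sub_of_hasDerivAt
    (fun σ hσ => hasDerivAt_kernel γ a y ((lt_min one_pos hR).trans_le hσ.1))
    (((hint _ _).sub (hint _ _)).add (hint _ _)),
    intervalIntegral.integral_add ((hint _ _).sub (hint _ _)) (hint _ _),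
    intervalIntegral.integral_sub (hint _ _) (hint _ _)]
  simp only [intervalIntegral.integral_const_mul]

-- Integration by parts against the oscillating factor gains two powers of `σ`.
lemma exists_tendsto_integral_kernel_add_three (ha : a.re = 0) (ha₀ : a ≠ 0) (hy : y.re = 0)
    (hγ : γ.re < -1)
    (h : ∃ L, Tendsto (fun R : ℝ => ∫ σ in (1 : ℝ)..R, kernel (γ + 1) a y σ) atTop (𝓝 L)) :
    ∃ L, Tendsto (fun R : ℝ => ∫ σ in (1 : ℝ)..R, kernel (γ + 3) a y σ) atTop (𝓝 L) := by
  obtain ⟨L₁, h₁⟩ := h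
  obtain ⟨L₀, h₀⟩ := exists_tendsto_integral_kernel_of_lt_neg_one ha hy hγ
  have hzero : Tendsto (kernel (γ + 1) a y) atTop (𝓝 0) :=
    tendsto_kernel_atTop ha hy (by rw [Complex.add_re, Complex.one_re]; linarith)
  refine ⟨_, ((((h₀.const_mul (γ + 1)).add (h₁.const_mul y)).sub
    (hzero.sub_const (kernel (γ + 1) a y 1))).const_mul a⁻¹).congr' ?_⟩
  filter_upwards [eventually_gt_atTop 0] with R hR
  rw [← integral_deriv_kernel γ a y hR]
  field_simp
  ring

theorem exists_tendsto_integral_kernel (hγ : -1 < γ.re) (hγ' : γ.re < 2) (ha : a.re = 0)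
    (ha₀ : a ≠ 0) (hy : y.re = 0) :
    ∃ L, Tendsto (fun R : ℝ => ∫ σ in (0 : ℝ)..R, kernel γ a y σ) atTop (𝓝 L) := by
  have hstep (β : ℂ) (hβ : β.re < 2)
      (h : ∃ L, Tendsto (fun R : ℝ => ∫ σ in (1 : ℝ)..R, kernel (β - 2) a y σ) atTop (𝓝 L)) :
      ∃ L, Tendsto (fun R : ℝ => ∫ σ in (1 : ℝ)..R, kernel β a y σ) atTop (𝓝 L) := by
    rw [← sub_add_cancel β 3]
    refine exists_tendsto_integral_kernel_add_three ha ha₀ hy ?_ ?_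
    · rw [Complex.sub_re, Complex.re_ofNat]
      linarith
    · rwa [show β - 3 + 1 = β - 2 by ring]
  obtain ⟨L, hL⟩ := hstep γ hγ' <| hstep (γ - 2) (by simp; linarith) <|
    exists_tendsto_integral_kernel_of_lt_neg_one ha hy (by simp; linarith)
  refine ⟨(∫ σ in (0 : ℝ)..1, kernel γ a y σ) + L, (hL.const_add _).congr fun R => ?_⟩
  exact intervalIntegral.integral_add_adjacent_intervals (intervalIntegrable_kernel hγ a y _ _)
    (intervalIntegrable_kernel hγ a y _ _)

end ImproperIntegral

section Convergence

lemma continuousOn_expIntegrand (γ s : ℂ) (x : ℝ) :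
    ContinuousOn (expIntegrand γ s x) (Ioi 0) := by
  rw [expIntegrand_eq_kernel]
  exact continuousOn_const.mul (continuousOn_kernel _ _ _)

variable {γ A : ℂ} (hγ : -1 < γ.re) (hγ' : γ.re < 2) {x : ℝ}
include hγ

lemma intervalIntegrable_expIntegrand (s : ℂ) (x b c : ℝ) :
    IntervalIntegrable (expIntegrand γ s x) volume b c := by
  rw [expIntegrand_eq_kernel]
  exact (intervalIntegrable_kernel hγ _ _ b c).const_mul _

include hγ'

lemma exists_tendsto_integral_expIntegrand {s : ℂ} (hs : s.re = 0) (hs₀ : s ≠ 0) (x : ℝ) :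
    ∃ L, Tendsto (fun R : ℝ => ∫ σ in (0 : ℝ)..R, expIntegrand γ s x σ) atTop (𝓝 L) := by
  obtain ⟨L, hL⟩ := exists_tendsto_integral_kernel (a := -s) (y := s * x) hγ hγ' (by simp [hs])
    (neg_ne_zero.2 hs₀) (by simp [hs])
  simp only [expIntegrand_eq_kernel, intervalIntegral.integral_const_mul]
  exact ⟨_, hL.const_mul _⟩

lemma HasOscIntegral.tendsto_integral_expIntegrand {c d : ℂ}
    (h : HasOscIntegral (fun σ => c * expIntegrand γ Complex.I x σ +
      d * expIntegrand γ (-Complex.I) x σ) A) :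
    Tendsto (fun R : ℝ => ∫ σ in (0 : ℝ)..R, (c * expIntegrand γ Complex.I x σ +
      d * expIntegrand γ (-Complex.I) x σ)) atTop (𝓝 A) := by
  obtain ⟨L, hL⟩ := exists_tendsto_integral_expIntegrand hγ hγ' (s := Complex.I) (by simp)
    Complex.I_ne_zero x
  obtain ⟨M, hM⟩ := exists_tendsto_integral_expIntegrand hγ hγ' (s := -Complex.I) (by simp)
    (neg_ne_zero.2 Complex.I_ne_zero) x
  have hint (c s : ℂ) (a b : ℝ) :
      IntervalIntegrable (fun σ => c * expIntegrand γ s x σ) volume a b :=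
    (intervalIntegrable_expIntegrand hγ s x a b).const_mul c
  refine h.tendsto_intervalIntegral (L := c * L + d * M)
    ((continuousOn_const.mul (continuousOn_expIntegrand γ _ x)).add
      (continuousOn_const.mul (continuousOn_expIntegrand γ _ x)))
    (fun a b => (hint _ _ a b).add (hint _ _ a b)) ?_
  refine ((hL.const_mul c).add (hM.const_mul d)).congr fun R => ?_
  rw [intervalIntegral.integral_add (hint _ _ 0 R) (hint _ _ 0 R),
    intervalIntegral.integral_const_mul, intervalIntegral.integral_const_mul]

theorem tendsto_integral_aiIntegrand (h : HasOscIntegral (aiIntegrand γ x) A) :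
    Tendsto (fun R : ℝ => ∫ σ in (0 : ℝ)..R, aiIntegrand γ x σ) atTop (𝓝 A) := by
  rw [aiIntegrand_eq_expIntegrand] at h ⊢
  exact h.tendsto_integral_expIntegrand hγ hγ'

theorem tendsto_integral_giIntegrand (h : HasOscIntegral (giIntegrand γ x) A) :
    Tendsto (fun R : ℝ => ∫ σ in (0 : ℝ)..R, giIntegrand γ x σ) atTop (𝓝 A) := by
  rw [giIntegrand_eq_expIntegrand] at h ⊢
  exact h.tendsto_integral_expIntegrand hγ hγ'

end Convergence

end GenAiry

theorem proposition4p1 :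
    -- the minors, whenever both `γ` and `-1 - γ` have real part larger than `-1`
    (∀ γ : ℂ, -1 < γ.re → γ.re < 0 → ∀ x : ℝ,
      GenAiry.bracket (GenAiry.Ai γ) (GenAiry.Gi γ) x
          = Complex.Gamma (1 + γ) / (Real.pi : ℂ) * GenAiry.Ai (-1 - γ) x ∧
      GenAiry.bracket (GenAiry.Ai γ) (GenAiry.Hi γ) x
          = Complex.Gamma (1 + γ) / (Real.pi : ℂ) *
            (-Complex.cos ((Real.pi : ℂ) * γ) * GenAiry.Ai (-1 - γ) x
              - Complex.sin ((Real.pi : ℂ) * γ) * GenAiry.Gi (-1 - γ) x) ∧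
      GenAiry.bracket (GenAiry.Gi γ) (GenAiry.Hi γ) x
          = Complex.Gamma (1 + γ) / (Real.pi : ℂ) *
            (Complex.sin ((Real.pi : ℂ) * γ) * GenAiry.Ai (-1 - γ) x
              - Complex.cos ((Real.pi : ℂ) * γ) * GenAiry.Gi (-1 - γ) x
              + GenAiry.Hi (-1 - γ) x)) ∧
    -- the Wronskian and the fundamental system
    (∀ γ : ℂ, -1 < γ.re →
      (∀ x : ℝ, GenAiry.wronskian ![GenAiry.Ai γ, GenAiry.Gi γ, GenAiry.Hi γ] x
          = Complex.Gamma (γ + 1) / (Real.pi : ℂ) ^ 2) ∧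
      GenAiry.IsFundamentalSystem γ ![GenAiry.Ai γ, GenAiry.Gi γ, GenAiry.Hi γ]) ∧
    -- the defining integrals converge, for `Re γ < 2` also as improper integrals
    (∀ γ : ℂ, -1 < γ.re → ∀ x : ℝ,
      GenAiry.HasOscIntegral (GenAiry.aiIntegrand γ x) ((Real.pi : ℂ) * GenAiry.Ai γ x) ∧
      GenAiry.HasOscIntegral (GenAiry.giIntegrand γ x) ((Real.pi : ℂ) * GenAiry.Gi γ x) ∧
      IntegrableOn (GenAiry.hiIntegrand γ x) (Ioi 0) ∧
      (γ.re < 2 →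
        Tendsto (fun R : ℝ => ∫ σ in (0 : ℝ)..R, GenAiry.aiIntegrand γ x σ) atTop
          (𝓝 ((Real.pi : ℂ) * GenAiry.Ai γ x)) ∧
        Tendsto (fun R : ℝ => ∫ σ in (0 : ℝ)..R, GenAiry.giIntegrand γ x σ) atTop
          (𝓝 ((Real.pi : ℂ) * GenAiry.Gi γ x)))) := by
  refine ⟨fun γ h h' x => ⟨GenAiry.bracket_Ai_Gi h h' x, GenAiry.bracket_Ai_Hi h h' x,
    GenAiry.bracket_Gi_Hi h h' x⟩, fun γ h => ⟨GenAiry.wronskian_Ai_Gi_Hi h,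
    GenAiry.isFundamentalSystem_Ai_Gi_Hi h⟩, fun γ h x => ?_⟩
  have hA := GenAiry.hasOscIntegral_Ai h x
  have hG := GenAiry.hasOscIntegral_Gi h x
  refine ⟨hA, hG, ?_, fun h2 => ⟨GenAiry.tendsto_integral_aiIntegrand h h2 hA,
    GenAiry.tendsto_integral_giIntegrand h h2 hG⟩⟩
  rw [GenAiry.hiIntegrand_eq_kernel]
  exact GenAiry.integrableOn_kernel h (by simp) _
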